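/- Let $M$ be a finite monoid. The dynamic problem $\mathrm{RangeEval}(M)$ is to maintain a sequence $m_0\ldots m_{n-1}$ of elements of $M$ (initially all equal to the neutral element) under the change operations $\mathrm{set}_m(i)$, for $m\in M$, which replace $m_i$ by $m$, and to support the query $\mathrm{range}(\ell,r)$, which asks for the product $m_\ell\circ\cdots\circ m_r$ (the neutral element if $r<\ell$); since elements of $M$ are not domain elements, the answer to the query is given by the relations $\mathrm{range}_m(\ell,r)$, $m\in M$, which state that the product equals $m$. A dynamic program for a dynamic problem on the domain $\{0,\ldots,n-1\}$ maintains an auxiliary structure over the same domain and over a fixed finite schema of relation symbols and partial function symbols, which is initialized by first-order formulas over $\leq,+,\times$. For each change operation $\delta(\bar p)$ and each auxiliary symbol it has one update rule, and for each query operation one query rule. An update rule runs an initial procedure once and then, for every tuple $\bar x$ with $x_i\le g_i(n)$, replaces the value of the symbol at a tuple of terms in $\bar p,\bar x$ by what a main procedure returns. Procedures consist of sequences of assignments to local symbols, if-branches and parallel branches over $z\le g(n)$; their terms and conditions are built from variables, $\le$, $+$, $\times$, the auxiliary and local symbols, if-then-else, Boolean connectives, and the expressions $\mathbf{exists}\ z\le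 g(n)$ and $\mathbf{unique}\ z\le g(n)$; all $g,g_i$ are first-order definable from $\leq,+,\times$. A program may also declare supplementary instances of other dynamic problems, which are themselves maintained by such programs; every procedure may query them, and initial procedures may change them. The program is independent of $n$, and it must answer all queries correctly after every sequence of changes, for every $n$. The work of a rule is defined inductively: atoms cost $1$, compound expressions and sequences cost the maximum over their parts, an $\mathbf{exists}$, $\mathbf{unique}$ or parallel branching over $z\le g(n)$ multiplies the cost of its body by $g(n)+1$, and an operation on a supplementary instance costs the work of the program for that instance. An update rule costs the maximum of the cost of its initial procedure and of $\prod_i (g_i(n)+1)$ times the cost of its main procedure and target terms. The work of a change operation is the maximum over its update rules. Then, for every $\varepsilon>0$, there is a dynamic program for $\mathrm{RangeEval}(M)$ in this sense (that is, $\mathrm{RangeEval}(M)$ can be maintained in $\mathrm{DynFO}$) such that the work of every change operation and of every query operation on domains of size $n$ is $O(n^{\varepsilon})$ as $n\to\infty$. -/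

import Mathlib

open Filter Asymptotics

universe u

namespace DynFO

/-! ## First-order logic with order and arithmetic on the domain `{0, …, n-1}` -/

/-- Symbols for the linear order and the graphs of addition and multiplication. -/
inductive ArithRel : ℕ → Type
  | le : ArithRel 2
  | add : ArithRel 3
  | mul : ArithRel 3

/-- The language of `≤, +, ×` (with `+` and `×` as ternary relations, since they are partial
on a finite domain). -/
def arith : FirstOrder.Language where
  Functions := fun _ => Empty
  Relations := ArithRel

/-- The standard interpretation of `≤, +, ×` on the domain `{0, …, n-1}`. -/
instance arithStructure (n : ℕ) : arith.Structure (Fin n) where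
  funMap := fun f _ => nomatch f
  RelMap := fun R x =>
    match R with
    | ArithRel.le => x 0 ≤ x 1
    | ArithRel.add => (x 0 : ℕ) + (x 1 : ℕ) = (x 2 : ℕ)
    | ArithRel.mul => (x 0 : ℕ) * (x 1 : ℕ) = (x 2 : ℕ)

/-- A function `g : ℕ → ℕ` that is first-order definable from `≤, +, ×`: one formula says, in the
domain of each size `n`, which elements are `≤ g n`. Values `g n ≥ n` are allowed. -/
structure Bound where
  toFun : ℕ → ℕ
  definable : ∃ φ : arith.Formula (Fin 1), ∀ (n : ℕ) (a : Fin n),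
    φ.Realize (fun _ => a) ↔ (a : ℕ) ≤ toFun n

/-! ## Dynamic problems and structures -/

/-- A dynamic problem: for every domain size `n` a set of states with an initial state, finitely
many change operations, finitely many relational queries (tuples to truth values) and finitely
many functional queries (tuples to domain elements, or undefined). -/
structure DynProblem where
  Change : Type u
  RelQuery : Type u
  FunQuery : Type u
  finChange : Finite Change
  finRelQuery : Finite RelQuery
  finFunQuery : Finite FunQuery
  changeArity : Change → ℕ
  relArity : RelQuery → ℕ
  funArity : FunQuery → ℕ
  State : ℕ → Type u
  start : (n : ℕ) → State n
  apply : {n : ℕ} → (δ : Change) → (Fin (changeArity δ) → Fin n) → State n → State n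
  holds : {n : ℕ} → (q : RelQuery) → (Fin (relArity q) → Fin n) → State n → Prop
  value : {n : ℕ} → (q : FunQuery) → (Fin (funArity q) → Fin n) → State n → Option (Fin n)

/-- A finite schema of relation and function symbols. -/
structure Schema where
  Rel : Type u
  Fun : Type u
  fintypeRel : Fintype Rel
  fintypeFun : Fintype Fun
  relArity : Rel → ℕ
  funArity : Fun → ℕ

attribute [instance] Schema.fintypeRel Schema.fintypeFun

/-- Structures with domain `{0, …, n-1}`; functions are partial, `none` being "undefined". -/
structure Str (σ : Schema.{u}) (n : ℕ) where
  rel : (R : σ.Rel) → (Fin (σ.relArity R) → Fin n) → Prop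
  fn : (f : σ.Fun) → (Fin (σ.funArity f) → Fin n) → Option (Fin n)

/-- What a dynamic program may refer to: auxiliary symbols, symbols that are only assigned locally
inside a procedure, and finitely many supplementary instances of dynamic problems. -/
structure Vocab where
  aux : Schema.{u}
  loc : Schema.{u}
  Inst : Type u
  finInst : Finite Inst
  prob : Inst → DynProblem.{u}

/-! ## Terms and conditions -/

mutual

/-- Terms with free variables `0, …, k-1`. -/
inductive Term (V : Vocab.{u}) : ℕ → Type u
  | var {k : ℕ} (i : Fin k) : Term V k
  | undef {k : ℕ} : Term V k
  | fn {k : ℕ} (f : V.aux.Fun) (args : Fin (V.aux.funArity f) → Term V k) : Term V k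
  | locFn {k : ℕ} (f : V.loc.Fun) (args : Fin (V.loc.funArity f) → Term V k) : Term V k
  | add {k : ℕ} (s t : Term V k) : Term V k
  | mul {k : ℕ} (s t : Term V k) : Term V k
  | ite {k : ℕ} (c : Cond V k) (s t : Term V k) : Term V k
  | query {k : ℕ} (i : V.Inst) (q : (V.prob i).FunQuery)
      (args : Fin ((V.prob i).funArity q) → Term V k) : Term V k
  /-- `unique z ≤ g(n) : c`; the bound variable `z` is the last one. -/
  | unique {k : ℕ} (g : Bound) (c : Cond V (k + 1)) : Term V k

/-- Conditions with free variables `0, …, k-1`. -/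
inductive Cond (V : Vocab.{u}) : ℕ → Type u
  | rel {k : ℕ} (R : V.aux.Rel) (args : Fin (V.aux.relArity R) → Term V k) : Cond V k
  | locRel {k : ℕ} (R : V.loc.Rel) (args : Fin (V.loc.relArity R) → Term V k) : Cond V k
  | eq {k : ℕ} (s t : Term V k) : Cond V k
  | le {k : ℕ} (s t : Term V k) : Cond V k
  | not {k : ℕ} (c : Cond V k) : Cond V k
  | and {k : ℕ} (c d : Cond V k) : Cond V k
  | or {k : ℕ} (c d : Cond V k) : Cond V k
  | query {k : ℕ} (i : V.Inst) (q : (V.prob i).RelQuery)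
      (args : Fin ((V.prob i).relArity q) → Term V k) : Cond V k
  /-- `exists z ≤ g(n) : c`; the bound variable `z` is the last one. -/
  | ex {k : ℕ} (g : Bound) (c : Cond V (k + 1)) : Cond V k

end

/-- What a procedure works on: the auxiliary structure, the local symbols, and the states of the
supplementary instances. -/
structure Ctx (V : Vocab.{u}) (n : ℕ) where
  aux : Str V.aux n
  loc : Str V.loc n
  sup : (i : V.Inst) → (V.prob i).State n

/-- A tuple of possibly undefined values is defined iff all its components are. -/
def collect {m n : ℕ} (v : Fin m → Option (Fin n)) : Option (Fin m → Fin n) :=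
  if h : ∀ i, (v i).isSome then some (fun i => (v i).get (h i)) else none

/-- An element of the domain, if the number is small enough. -/
def toDomain (n a : ℕ) : Option (Fin n) :=
  if h : a < n then some ⟨a, h⟩ else none

/-- Extend an assignment by a value for a new last variable. -/
def push {k n : ℕ} (e : Fin k → Fin n) (a : Fin n) : Fin (k + 1) → Fin n :=
  Fin.snoc (α := fun _ => Fin n) e a

noncomputable section

open Classical in
mutual

/-- The value of a term. Functions of undefined arguments are undefined. -/
def Term.eval {V : Vocab.{u}} {n : ℕ} (C : Ctx V n) :
    {k : ℕ} → Term V k → (Fin k → Fin n) → Option (Fin n)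
  | _, .var i, e => some (e i)
  | _, .undef, _ => none
  | _, .fn f args, e => (collect fun i => (args i).eval C e).bind (C.aux.fn f)
  | _, .locFn f args, e => (collect fun i => (args i).eval C e).bind (C.loc.fn f)
  | _, .add s t, e =>
      (s.eval C e).bind fun a => (t.eval C e).bind fun b => toDomain n ((a : ℕ) + (b : ℕ))
  | _, .mul s t, e =>
      (s.eval C e).bind fun a => (t.eval C e).bind fun b => toDomain n ((a : ℕ) * (b : ℕ))
  | _, .ite c s t, e => if c.eval C e then s.eval C e else t.eval C e
  | _, .query i q args, e =>
      (collect fun j => (args j).eval C e).bind fun v => (V.prob i).value q v (C.sup i)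
  | _, .unique g c, e =>
      if h : ∃ a : Fin n, (a : ℕ) ≤ g.toFun n ∧ c.eval C (push e a) then some h.choose else none

/-- The truth of a condition. Atoms with undefined arguments are false. -/
def Cond.eval {V : Vocab.{u}} {n : ℕ} (C : Ctx V n) :
    {k : ℕ} → Cond V k → (Fin k → Fin n) → Prop
  | _, .rel R args, e => ∃ v, (collect fun i => (args i).eval C e) = some v ∧ C.aux.rel R v
  | _, .locRel R args, e => ∃ v, (collect fun i => (args i).eval C e) = some v ∧ C.loc.rel R v
  | _, .eq s t, e => ∃ a, s.eval C e = some a ∧ t.eval C e = some a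
  | _, .le s t, e => ∃ a b, s.eval C e = some a ∧ t.eval C e = some b ∧ a ≤ b
  | _, .not c, e => ¬ c.eval C e
  | _, .and c d, e => c.eval C e ∧ d.eval C e
  | _, .or c d, e => c.eval C e ∨ d.eval C e
  | _, .query i q args, e =>
      ∃ v, (collect fun j => (args j).eval C e) = some v ∧ (V.prob i).holds q v (C.sup i)
  | _, .ex g c, e => ∃ a : Fin n, (a : ℕ) ≤ g.toFun n ∧ c.eval C (push e a)

end

mutual

/-- The evaluation of a term respects the demand on `unique`: whenever such an expression is
evaluated, there is exactly one suitable element. -/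
def Term.Ok {V : Vocab.{u}} {n : ℕ} (C : Ctx V n) :
    {k : ℕ} → Term V k → (Fin k → Fin n) → Prop
  | _, .var _, _ => True
  | _, .undef, _ => True
  | _, .fn _ args, e => ∀ i, (args i).Ok C e
  | _, .locFn _ args, e => ∀ i, (args i).Ok C e
  | _, .add s t, e => s.Ok C e ∧ t.Ok C e
  | _, .mul s t, e => s.Ok C e ∧ t.Ok C e
  | _, .ite c s t, e => c.Ok C e ∧ (c.eval C e → s.Ok C e) ∧ (¬ c.eval C e → t.Ok C e)
  | _, .query _ _ args, e => ∀ i, (args i).Ok C e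
  | _, .unique g c, e => (∀ a : Fin n, (a : ℕ) ≤ g.toFun n → c.Ok C (push e a)) ∧
      ∃! a : Fin n, (a : ℕ) ≤ g.toFun n ∧ c.eval C (push e a)

/-- The evaluation of a condition respects the demand on `unique`. -/
def Cond.Ok {V : Vocab.{u}} {n : ℕ} (C : Ctx V n) :
    {k : ℕ} → Cond V k → (Fin k → Fin n) → Prop
  | _, .rel _ args, e => ∀ i, (args i).Ok C e
  | _, .locRel _ args, e => ∀ i, (args i).Ok C e
  | _, .eq s t, e => s.Ok C e ∧ t.Ok C e
  | _, .le s t, e => s.Ok C e ∧ t.Ok C e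
  | _, .not c, e => c.Ok C e
  | _, .and c d, e => c.Ok C e ∧ d.Ok C e
  | _, .or c d, e => c.Ok C e ∧ d.Ok C e
  | _, .query _ _ args, e => ∀ i, (args i).Ok C e
  | _, .ex g c, e => ∀ a : Fin n, (a : ℕ) ≤ g.toFun n → c.Ok C (push e a)

end

/-! ## Work of terms and conditions -/

/-- For each operation of a dynamic problem, its work as a function of the domain size. -/
structure OpWork (D : DynProblem.{u}) where
  change : D.Change → ℕ → ℕ
  relQuery : D.RelQuery → ℕ → ℕ
  funQuery : D.FunQuery → ℕ → ℕ

mutual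

/-- The work of a term, given the work of the supplementary instances. A variable bounded by `g`
contributes the factor `g n + 1`, the number of values up to `g n`. -/
def Term.work {V : Vocab.{u}} (w : (i : V.Inst) → OpWork (V.prob i)) (n : ℕ) :
    {k : ℕ} → Term V k → ℕ
  | _, .var _ => 1
  | _, .undef => 1
  | _, .fn _ args => max 1 (Finset.univ.sup fun i => (args i).work w n)
  | _, .locFn _ args => max 1 (Finset.univ.sup fun i => (args i).work w n)
  | _, .add s t => max (s.work w n) (t.work w n)
  | _, .mul s t => max (s.work w n) (t.work w n)
  | _, .ite c s t => max (c.work w n) (max (s.work w n) (t.work w n))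
  | _, .query i q args =>
      max (max 1 ((w i).funQuery q n)) (Finset.univ.sup fun j => (args j).work w n)
  | _, .unique g c => (g.toFun n + 1) * c.work w n

/-- The work of a condition. -/
def Cond.work {V : Vocab.{u}} (w : (i : V.Inst) → OpWork (V.prob i)) (n : ℕ) :
    {k : ℕ} → Cond V k → ℕ
  | _, .rel _ args => max 1 (Finset.univ.sup fun i => (args i).work w n)
  | _, .locRel _ args => max 1 (Finset.univ.sup fun i => (args i).work w n)
  | _, .eq s t => max (s.work w n) (t.work w n)
  | _, .le s t => max (s.work w n) (t.work w n)
  | _, .not c => c.work w n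
  | _, .and c d => max (c.work w n) (d.work w n)
  | _, .or c d => max (c.work w n) (d.work w n)
  | _, .query i q args =>
      max (max 1 ((w i).relQuery q n)) (Finset.univ.sup fun j => (args j).work w n)
  | _, .ex g c => (g.toFun n + 1) * c.work w n

end

/-! ## Procedures -/

/-- Instructions that may be used in initial and in main procedures. -/
inductive Instr (V : Vocab.{u}) : ℕ → Type u
  | skip {k : ℕ} : Instr V k
  | seq {k : ℕ} (P Q : Instr V k) : Instr V k
  | assignFn {k : ℕ} (f : V.loc.Fun) (args : Fin (V.loc.funArity f) → Term V k)
      (t : Term V k) : Instr V k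
  | assignRel {k : ℕ} (R : V.loc.Rel) (args : Fin (V.loc.relArity R) → Term V k)
      (c : Cond V k) : Instr V k
  | ite {k : ℕ} (c : Cond V k) (P Q : Instr V k) : Instr V k
  /-- `for z ≤ g(n) pardo P`; the bound variable `z` is the last one. -/
  | par {k : ℕ} (g : Bound) (P : Instr V (k + 1)) : Instr V k

/-- A set of assignments to the symbols of a schema; `none` means "not assigned". -/
structure Delta (σ : Schema.{u}) (n : ℕ) where
  rel : (R : σ.Rel) → (Fin (σ.relArity R) → Fin n) → Option Prop
  fn : (f : σ.Fun) → (Fin (σ.funArity f) → Fin n) → Option (Option (Fin n))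

/-- Carry out a set of assignments. -/
def Str.assign {σ : Schema.{u}} {n : ℕ} (A : Str σ n) (d : Delta σ n) : Str σ n where
  rel := fun R v => (d.rel R v).getD (A.rel R v)
  fn := fun f v => (d.fn f v).getD (A.fn f v)

/-- Carry out a set of assignments to the local symbols. -/
def Ctx.assign {V : Vocab.{u}} {n : ℕ} (C : Ctx V n) (d : Delta V.loc n) : Ctx V n :=
  { C with loc := C.loc.assign d }

open Classical in
/-- The assignments made by an instruction. The branches of a parallel branching all start from
the same context and do not see each other's assignments. -/
def Instr.run {V : Vocab.{u}} {n : ℕ} :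
    {k : ℕ} → Instr V k → Ctx V n → (Fin k → Fin n) → Delta V.loc n
  | _, .skip, _, _ => ⟨fun _ _ => none, fun _ _ => none⟩
  | _, .seq P Q, C, e =>
      let d := P.run C e
      let d' := Q.run (C.assign d) e
      ⟨fun R v => (d'.rel R v).or (d.rel R v), fun f v => (d'.fn f v).or (d.fn f v)⟩
  | _, .assignFn f args t, C, e =>
      ⟨fun _ _ => none, fun f' v =>
        if (collect fun i => (args i).eval C e).map
            (fun a => (⟨f, a⟩ : (f : V.loc.Fun) × (Fin (V.loc.funArity f) → Fin n))) = some ⟨f', v⟩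
        then some (t.eval C e) else none⟩
  | _, .assignRel R args c, C, e =>
      ⟨fun R' v =>
        if (collect fun i => (args i).eval C e).map
            (fun a => (⟨R, a⟩ : (R : V.loc.Rel) × (Fin (V.loc.relArity R) → Fin n))) = some ⟨R', v⟩
        then some (c.eval C e) else none, fun _ _ => none⟩
  | _, .ite c P Q, C, e => if c.eval C e then P.run C e else Q.run C e
  | _, .par g P, C, e =>
      ⟨fun R v =>
        if h : ∃ a : Fin n, (a : ℕ) ≤ g.toFun n ∧ (P.run C (push e a)).rel R v ≠ none
        then (P.run C (push e h.choose)).rel R v else none,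
       fun f v =>
        if h : ∃ a : Fin n, (a : ℕ) ≤ g.toFun n ∧ (P.run C (push e a)).fn f v ≠ none
        then (P.run C (push e h.choose)).fn f v else none⟩

/-- Well-definedness of an execution: the demand on `unique` is respected, and distinct branches
of a parallel branching never assign to the same location. -/
def Instr.Ok {V : Vocab.{u}} {n : ℕ} :
    {k : ℕ} → Instr V k → Ctx V n → (Fin k → Fin n) → Prop
  | _, .skip, _, _ => True
  | _, .seq P Q, C, e => P.Ok C e ∧ Q.Ok (C.assign (P.run C e)) e
  | _, .assignFn _ args t, C, e => (∀ i, (args i).Ok C e) ∧ t.Ok C e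
  | _, .assignRel _ args c, C, e => (∀ i, (args i).Ok C e) ∧ c.Ok C e
  | _, .ite c P Q, C, e => c.Ok C e ∧ (c.eval C e → P.Ok C e) ∧ (¬ c.eval C e → Q.Ok C e)
  | _, .par g P, C, e =>
      (∀ a : Fin n, (a : ℕ) ≤ g.toFun n → P.Ok C (push e a)) ∧
      ∀ a b : Fin n, (a : ℕ) ≤ g.toFun n → (b : ℕ) ≤ g.toFun n → a ≠ b →
        (∀ R v, (P.run C (push e a)).rel R v = none ∨ (P.run C (push e b)).rel R v = none) ∧
        (∀ f v, (P.run C (push e a)).fn f v = none ∨ (P.run C (push e b)).fn f v = none)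

/-- The syntactic demand on assignments in the scope of parallel branchings: each variable bound
by one of these (the variables in `B`) occurs as an argument on the left-hand side. -/
def Instr.Scoped {V : Vocab.{u}} : {k : ℕ} → Instr V k → Set (Fin k) → Prop
  | _, .skip, _ => True
  | _, .seq P Q, B => P.Scoped B ∧ Q.Scoped B
  | _, .assignFn _ args _, B => ∀ z ∈ B, ∃ i, args i = Term.var z
  | _, .assignRel _ args _, B => ∀ z ∈ B, ∃ i, args i = Term.var z
  | _, .ite _ P Q, B => P.Scoped B ∧ Q.Scoped B
  | _, .par _ P, B => P.Scoped (insert (Fin.last _) (Fin.castSucc '' B))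

/-- The work of an instruction. -/
def Instr.work {V : Vocab.{u}} (w : (i : V.Inst) → OpWork (V.prob i)) (n : ℕ) :
    {k : ℕ} → Instr V k → ℕ
  | _, .skip => 1
  | _, .seq P Q => max (P.work w n) (Q.work w n)
  | _, .assignFn _ args t => max (t.work w n) (Finset.univ.sup fun i => (args i).work w n)
  | _, .assignRel _ args c => max (c.work w n) (Finset.univ.sup fun i => (args i).work w n)
  | _, .ite c P Q => max (c.work w n) (max (P.work w n) (Q.work w n))
  | _, .par g P => (g.toFun n + 1) * P.work w n

/-- Initial procedures, which may change supplementary instances, though not inside parallel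
branchings. -/
inductive Initial (V : Vocab.{u}) (k : ℕ) : Type u
  | instr (P : Instr V k) : Initial V k
  | seq (P Q : Initial V k) : Initial V k
  | ite (c : Cond V k) (P Q : Initial V k) : Initial V k
  | change (i : V.Inst) (δ : (V.prob i).Change)
      (args : Fin ((V.prob i).changeArity δ) → Term V k) : Initial V k

open Classical in
/-- The effect of an initial procedure on the context. -/
def Initial.run {V : Vocab.{u}} {n k : ℕ} :
    Initial V k → Ctx V n → (Fin k → Fin n) → Ctx V n
  | .instr P, C, e => C.assign (P.run C e)
  | .seq P Q, C, e => Q.run (P.run C e) e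
  | .ite c P Q, C, e => if c.eval C e then P.run C e else Q.run C e
  | .change i δ args, C, e =>
      match collect fun j => (args j).eval C e with
      | some v => { C with sup := Function.update C.sup i ((V.prob i).apply δ v (C.sup i)) }
      | none => C

/-- Well-definedness of the execution of an initial procedure. -/
def Initial.Ok {V : Vocab.{u}} {n k : ℕ} :
    Initial V k → Ctx V n → (Fin k → Fin n) → Prop
  | .instr P, C, e => P.Ok C e
  | .seq P Q, C, e => P.Ok C e ∧ Q.Ok (P.run C e) e
  | .ite c P Q, C, e => c.Ok C e ∧ (c.eval C e → P.Ok C e) ∧ (¬ c.eval C e → Q.Ok C e)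
  | .change _ _ args, C, e => ∀ j, (args j).Ok C e

/-- The syntactic demand on assignments. -/
def Initial.Scoped {V : Vocab.{u}} {k : ℕ} : Initial V k → Prop
  | .instr P => P.Scoped ∅
  | .seq P Q => P.Scoped ∧ Q.Scoped
  | .ite _ P Q => P.Scoped ∧ Q.Scoped
  | .change _ _ _ => True

/-- The procedure contains a change operation for the supplementary instance `i`. -/
def Initial.Invokes {V : Vocab.{u}} {k : ℕ} (i : V.Inst) : Initial V k → Prop
  | .instr _ => False
  | .seq P Q => P.Invokes i ∨ Q.Invokes i
  | .ite _ P Q => P.Invokes i ∨ Q.Invokes i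
  | .change j _ _ => j = i

/-- The work of an initial procedure. -/
def Initial.work {V : Vocab.{u}} (w : (i : V.Inst) → OpWork (V.prob i)) (n : ℕ) {k : ℕ} :
    Initial V k → ℕ
  | .instr P => P.work w n
  | .seq P Q => max (P.work w n) (Q.work w n)
  | .ite c P Q => max (c.work w n) (max (P.work w n) (Q.work w n))
  | .change i δ args =>
      max (max 1 ((w i).change δ n)) (Finset.univ.sup fun j => (args j).work w n)

/-- Main procedures: each path ends with the return of an expression from `E` (which is the type
of conditions or the type of terms), and there is no return inside parallel branchings. -/
inductive Main (V : Vocab.{u}) (k : ℕ) (E : Type u) : Type u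
  | ret (x : E) : Main V k E
  | seq (P : Instr V k) (Q : Main V k E) : Main V k E
  | ite (c : Cond V k) (P Q : Main V k E) : Main V k E

open Classical in
/-- The context and the expression that are reached at the end of the execution. -/
def Main.run {V : Vocab.{u}} {n k : ℕ} {E : Type u} :
    Main V k E → Ctx V n → (Fin k → Fin n) → Ctx V n × E
  | .ret x, C, _ => (C, x)
  | .seq P Q, C, e => Q.run (C.assign (P.run C e)) e
  | .ite c P Q, C, e => if c.eval C e then P.run C e else Q.run C e

/-- A main procedure returns true. -/
def Main.returnsTrue {V : Vocab.{u}} {n k : ℕ} (P : Main V k (Cond V k)) (C : Ctx V n)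
    (e : Fin k → Fin n) : Prop :=
  (P.run C e).2.eval (P.run C e).1 e

/-- The value that a main procedure returns. -/
def Main.returnValue {V : Vocab.{u}} {n k : ℕ} (P : Main V k (Term V k)) (C : Ctx V n)
    (e : Fin k → Fin n) : Option (Fin n) :=
  (P.run C e).2.eval (P.run C e).1 e

/-- Well-definedness of the execution of a main procedure, given the same for expressions. -/
def Main.Ok {V : Vocab.{u}} {n k : ℕ} {E : Type u}
    (okE : Ctx V n → E → (Fin k → Fin n) → Prop) :
    Main V k E → Ctx V n → (Fin k → Fin n) → Prop
  | .ret x, C, e => okE C x e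
  | .seq P Q, C, e => P.Ok C e ∧ Q.Ok okE (C.assign (P.run C e)) e
  | .ite c P Q, C, e =>
      c.Ok C e ∧ (c.eval C e → P.Ok okE C e) ∧ (¬ c.eval C e → Q.Ok okE C e)

/-- The syntactic demand on assignments. -/
def Main.Scoped {V : Vocab.{u}} {k : ℕ} {E : Type u} : Main V k E → Prop
  | .ret _ => True
  | .seq P Q => P.Scoped ∅ ∧ Q.Scoped
  | .ite _ P Q => P.Scoped ∧ Q.Scoped

/-- The work of a main procedure, given the work of expressions. -/
def Main.work {V : Vocab.{u}} (w : (i : V.Inst) → OpWork (V.prob i)) (n : ℕ) {k : ℕ} {E : Type u}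
    (wE : E → ℕ) : Main V k E → ℕ
  | .ret x => max 1 (wE x)
  | .seq P Q => max (P.work w n) (Q.work w n wE)
  | .ite c P Q => max (c.work w n) (max (P.work w n wE) (Q.work w n wE))

/-! ## Rules and programs -/

/-- A rule that updates an `r`-ary symbol after a change operation with parameters
`p̄ = (p_0, …, p_(p-1))`: the initial procedure is executed once; then, for each tuple
`x̄` with `x_i ≤ g_i(n)`, the symbol is updated at the tuple `target (p̄, x̄)` to what the main
procedure returns. -/
structure UpdateRule (V : Vocab.{u}) (p r : ℕ) (E : ℕ → Type u) where
  first : Initial V p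
  numVars : ℕ
  bound : Fin numVars → Bound
  target : Fin r → Term V (p + numVars)
  main : Main V (p + numVars) (E (p + numVars))

namespace UpdateRule

variable {V : Vocab.{u}} {p r : ℕ} {E : ℕ → Type u} {n : ℕ}

/-- The tuples `x̄` that satisfy the constraint of the rule. -/
def Allowed (π : UpdateRule V p r E) (b : Fin π.numVars → Fin n) : Prop :=
  ∀ i, (b i : ℕ) ≤ (π.bound i).toFun n

/-- The tuple at which the symbol is updated, for given `p̄` and `x̄` (no update if undefined). -/
def targetAt (π : UpdateRule V p r E) (C : Ctx V n) (a : Fin p → Fin n)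
    (b : Fin π.numVars → Fin n) : Option (Fin r → Fin n) :=
  collect fun i => (π.target i).eval (π.first.run C a) (Fin.append a b)

/-- The updated relation. -/
def newRel (π : UpdateRule V p r (Cond V)) (C : Ctx V n) (a : Fin p → Fin n)
    (old : (Fin r → Fin n) → Prop) (v : Fin r → Fin n) : Prop :=
  (∃ b, π.Allowed b ∧ π.targetAt C a b = some v ∧
    π.main.returnsTrue (π.first.run C a) (Fin.append a b)) ∨
  (old v ∧ ¬ ∃ b, π.Allowed b ∧ π.targetAt C a b = some v)

open Classical in
/-- The updated function. -/
def newFn (π : UpdateRule V p r (Term V)) (C : Ctx V n) (a : Fin p → Fin n)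
    (old : (Fin r → Fin n) → Option (Fin n)) (v : Fin r → Fin n) : Option (Fin n) :=
  if h : ∃ b, π.Allowed b ∧ π.targetAt C a b = some v
  then π.main.returnValue (π.first.run C a) (Fin.append a h.choose)
  else old v

/-- Well-definedness of the execution of a rule, given the same for returned expressions. -/
def Ok (okE : {k : ℕ} → Ctx V n → E k → (Fin k → Fin n) → Prop) (π : UpdateRule V p r E)
    (C : Ctx V n) (a : Fin p → Fin n) : Prop :=
  π.first.Ok C a ∧ ∀ b, π.Allowed b →
    (∀ i, (π.target i).Ok (π.first.run C a) (Fin.append a b)) ∧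
    π.main.Ok okE (π.first.run C a) (Fin.append a b)

/-- Different tuples `x̄` never prescribe different values of a function at the same place. -/
def Consistent (π : UpdateRule V p r (Term V)) (C : Ctx V n) (a : Fin p → Fin n) : Prop :=
  ∀ b b', π.Allowed b → π.Allowed b' → ∀ v, π.targetAt C a b = some v →
    π.targetAt C a b' = some v →
    π.main.returnValue (π.first.run C a) (Fin.append a b) =
      π.main.returnValue (π.first.run C a) (Fin.append a b')

/-- The work of a rule: that of the initial procedure, and, once for each admissible `x̄`, that of
the main procedure and of the target terms. -/
def work (w : (i : V.Inst) → OpWork (V.prob i)) (wE : {k : ℕ} → E k → ℕ) (n : ℕ)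
    (π : UpdateRule V p r E) : ℕ :=
  max (π.first.work w n)
    ((∏ i, ((π.bound i).toFun n + 1)) *
      max (π.main.work w n wE) (Finset.univ.sup fun i => (π.target i).work w n))

end UpdateRule

/-- Dynamic programs for a dynamic problem: a finite auxiliary schema with a first-order definable
initialization (from `≤, +, ×`: the initial input structure carries no information beyond its
domain), one update rule per change operation and auxiliary symbol, and one query procedure per
query operation. The program does not depend on the domain size. -/
structure Program (D : DynProblem.{u}) where
  V : Vocab.{u}
  relStart : (R : V.aux.Rel) → arith.Formula (Fin (V.aux.relArity R))
  funStart : (f : V.aux.Fun) → arith.Formula (Fin (V.aux.funArity f + 1))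
  relRule : (δ : D.Change) → (R : V.aux.Rel) →
    UpdateRule V (D.changeArity δ) (V.aux.relArity R) (Cond V)
  funRule : (δ : D.Change) → (f : V.aux.Fun) →
    UpdateRule V (D.changeArity δ) (V.aux.funArity f) (Term V)
  relQuery : (q : D.RelQuery) → Main V (D.relArity q) (Cond V (D.relArity q))
  funQuery : (q : D.FunQuery) → Main V (D.funArity q) (Term V (D.funArity q))

namespace Program

variable {D : DynProblem.{u}} (P : Program D)

open Classical in
/-- The initial auxiliary structure. -/
def startAux (n : ℕ) : Str P.V.aux n where
  rel := fun R v => (P.relStart R).Realize v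
  fn := fun f v =>
    if h : ∃! b : Fin n, (P.funStart f).Realize (push v b) then some h.choose else none

/-- Procedures start with all local symbols empty. -/
def ctx {n : ℕ} (A : Str P.V.aux n) (U : (i : P.V.Inst) → (P.V.prob i).State n) : Ctx P.V n where
  aux := A
  loc := ⟨fun _ _ => False, fun _ _ => none⟩
  sup := U

/-- The auxiliary structure after a change; all rules are evaluated on the old context. -/
def nextAux {n : ℕ} (A : Str P.V.aux n) (U : (i : P.V.Inst) → (P.V.prob i).State n)
    (δ : D.Change) (a : Fin (D.changeArity δ) → Fin n) : Str P.V.aux n where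
  rel := fun R => (P.relRule δ R).newRel (P.ctx A U) a (A.rel R)
  fn := fun f => (P.funRule δ f).newFn (P.ctx A U) a (A.fn f)

/-- The initial procedure of the update rule for an auxiliary symbol. -/
def firstOf (δ : D.Change) : P.V.aux.Rel ⊕ P.V.aux.Fun → Initial P.V (D.changeArity δ)
  | .inl R => (P.relRule δ R).first
  | .inr f => (P.funRule δ f).first

open Classical in
/-- The supplementary instances after a change of the main instance. -/
def nextSup {n : ℕ} (A : Str P.V.aux n) (U : (i : P.V.Inst) → (P.V.prob i).State n)
    (δ : D.Change) (a : Fin (D.changeArity δ) → Fin n) (i : P.V.Inst) : (P.V.prob i).State n :=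
  if h : ∃ X, (P.firstOf δ X).Invokes i
  then ((P.firstOf δ h.choose).run (P.ctx A U) a).sup i
  else U i

/-- The syntactic demands on programs: those on assignments, and that for each change operation
and each supplementary instance at most one update rule changes this instance. -/
structure WellFormed : Prop where
  relRule : ∀ δ R, (P.relRule δ R).first.Scoped ∧ (P.relRule δ R).main.Scoped
  funRule : ∀ δ f, (P.funRule δ f).first.Scoped ∧ (P.funRule δ f).main.Scoped
  relQuery : ∀ q, (P.relQuery q).Scoped
  funQuery : ∀ q, (P.funQuery q).Scoped
  invokes : ∀ δ i X Y, (P.firstOf δ X).Invokes i → (P.firstOf δ Y).Invokes i → X = Y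

/-- The configurations (state of the problem, auxiliary structure, supplementary instances) that
are reached from the initial ones by sequences of change operations. -/
inductive Reachable (n : ℕ) : D.State n → Str P.V.aux n →
    ((i : P.V.Inst) → (P.V.prob i).State n) → Prop
  | start : Reachable n (D.start n) (P.startAux n) (fun i => (P.V.prob i).start n)
  | step {s : D.State n} {A : Str P.V.aux n} {U : (i : P.V.Inst) → (P.V.prob i).State n}
      (h : Reachable n s A U) (δ : D.Change) (a : Fin (D.changeArity δ) → Fin n) :
      Reachable n (D.apply δ a s) (P.nextAux A U δ a) (P.nextSup A U δ a)

/-- `P` is a dynamic program for `D`: on every domain and after every sequence of changes, all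
rules are well-defined and all queries are answered correctly. -/
structure Correct : Prop where
  wellFormed : P.WellFormed
  relRule_ok : ∀ n s A U, P.Reachable n s A U → ∀ δ a R,
    (P.relRule δ R).Ok (fun C c e => c.Ok C e) (P.ctx A U) a
  funRule_ok : ∀ n s A U, P.Reachable n s A U → ∀ δ a f,
    (P.funRule δ f).Ok (fun C t e => t.Ok C e) (P.ctx A U) a ∧
    (P.funRule δ f).Consistent (P.ctx A U) a
  relQuery_ok : ∀ n s A U, P.Reachable n s A U → ∀ q a,
    (P.relQuery q).Ok (fun C c e => c.Ok C e) (P.ctx A U) a ∧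
    ((P.relQuery q).returnsTrue (P.ctx A U) a ↔ D.holds q a s)
  funQuery_ok : ∀ n s A U, P.Reachable n s A U → ∀ q a,
    (P.funQuery q).Ok (fun C t e => t.Ok C e) (P.ctx A U) a ∧
    (P.funQuery q).returnValue (P.ctx A U) a = D.value q a s

/-- The work of the operations. The work of a change is the maximum of the work of its (constantly
many) update rules. -/
def opWork (w : (i : P.V.Inst) → OpWork (P.V.prob i)) : OpWork D where
  change := fun δ n =>
    max (Finset.univ.sup fun R => (P.relRule δ R).work w (fun c => c.work w n) n)
      (Finset.univ.sup fun f => (P.funRule δ f).work w (fun t => t.work w n) n)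
  relQuery := fun q n => (P.relQuery q).work w n (fun c => c.work w n)
  funQuery := fun q n => (P.funQuery q).work w n (fun t => t.work w n)

end Program

end

/-- The problem `D` has a dynamic program whose operations have the work `w`, where the
supplementary instances of the program are, recursively, maintained by dynamic programs. -/
inductive Maintains : (D : DynProblem.{u}) → OpWork D → Prop
  | intro {D : DynProblem.{u}} (P : Program D) (w : (i : P.V.Inst) → OpWork (P.V.prob i))
      (hsup : ∀ i, Maintains (P.V.prob i) (w i)) (hP : P.Correct) : Maintains D (P.opWork w)

/-- `D` can be maintained in DynFO with work `O(f(n))` per query and change operation. -/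
def MaintainableWithWork (D : DynProblem.{u}) (f : ℕ → ℝ) : Prop :=
  ∃ w : OpWork D, Maintains D w ∧
    (∀ δ, (fun n => (w.change δ n : ℝ)) =O[atTop] f) ∧
    (∀ q, (fun n => (w.relQuery q n : ℝ)) =O[atTop] f) ∧
    (∀ q, (fun n => (w.funQuery q n : ℝ)) =O[atTop] f)

/-- The product `m_ℓ ∘ ⋯ ∘ m_r` (in this order; the neutral element if `r < ℓ`). -/
def rangeProd {M : Type u} [Monoid M] {n : ℕ} (s : Fin n → M) (l r : Fin n) : M :=
  (((List.finRange n).filter fun i => l ≤ i ∧ i ≤ r).map s).prod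

/-- The problem RangeEval(M): a sequence of elements of `M`, initially all neutral, with the change
operations `set_m(i)` for `m ∈ M` and the query `range(ℓ, r)`. As elements of `M` are not domain
elements, the answer to the query is given by the relations `range_m(ℓ, r)`, for `m ∈ M`, which say
that the product is `m`. -/
def rangeEval (M : Type u) [Monoid M] [Finite M] : DynProblem.{u} where
  Change := M
  RelQuery := M
  FunQuery := PEmpty
  finChange := inferInstance
  finRelQuery := inferInstance
  finFunQuery := inferInstance
  changeArity := fun _ => 1
  relArity := fun _ => 2
  funArity := fun q => nomatch q
  State := fun n => Fin n → M
  start := fun _ _ => 1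
  apply := fun m v s => Function.update s (v 0) m
  holds := fun m v s => rangeProd s (v 0) (v 1) = m
  value := fun q _ _ => nomatch q

end DynFO

-- Choose `K ≥ 2 / ε` and `T = root K n + 1`, roughly the `(K+1)`-st root of `n`, with `T ^ (K + 1)
-- ≥ n`. The blocks of level `j` are the fibres of `i ↦ i / T ^ j`: single positions at level 0, one
-- block for everything at level `K + 1`, and each block splits into at most `T` blocks of the level
-- below. For every level `j ≤ K` the program stores the products over all ranges of sibling blocks,
-- that is, of blocks with the same parent.
--
-- A change at position `p` affects, at level `j`, only ranges inside the parent of the level-`j`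
-- block of `p`, so `T ^ 2` pairs of blocks need attention. A range containing that block is split
-- there (`prodOn_blockRange_split`) into the ranges strictly before and after it, which do not
-- contain `p` and keep their stored values, and the block itself, whose new product is built up
-- from level 0 in the same manner. No inverses are needed, and only old values are read, as it must
-- be when all rules see the old structure. Each new entry is thus given by a quantifier-free
-- condition of work 1 (`denotes_newEntry`), and the rules preserve the intended meaning of the
-- relations (`invariant_step`).
--
-- A query multiplies boundedly many stored products: a suffix at `l` climbing through the levels,
-- one range of blocks at the level where `l` and `r` lie in different blocks with a common parent,
-- and a prefix at `r` (`denotes_queryProd`). So queries have work 1 and changes have work at most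
-- `T ^ 2 ≤ 4 * n ^ (2 / (K + 1))`.
--
-- Two encodings serve the formal model. A value in `M` is a family of conditions indexed by `M`,
-- exactly one of which is true (`Cond.Denotes`). Division by `T` is not available as a term, so it
-- is stored in functions that are initialized by first-order formulas and never change.

namespace DynFO

/-! ## Uniform definability from `≤, +, ×` -/

/-- A single formula over `≤, +, ×` defines the predicate on the domain of each size. -/
def UniformlyDefinable {α : Type} (P : (n : ℕ) → (α → Fin n) → Prop) : Prop :=
  ∃ φ : arith.Formula α, ∀ (n : ℕ) (v : α → Fin n), φ.Realize v ↔ P n v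

namespace UniformlyDefinable

variable {α β : Type} {P Q : (n : ℕ) → (α → Fin n) → Prop}

theorem congr (h : UniformlyDefinable P) (hPQ : ∀ n v, P n v ↔ Q n v) : UniformlyDefinable Q := by
  obtain ⟨φ, hφ⟩ := h
  exact ⟨φ, fun n v => (hφ n v).trans (hPQ n v)⟩

theorem le (i j : α) : UniformlyDefinable fun _ v => v i ≤ v j :=
  ⟨FirstOrder.Language.Relations.formula (L := arith) ArithRel.le
    ![FirstOrder.Language.Term.var i, FirstOrder.Language.Term.var j],
    fun _ _ => FirstOrder.Language.Formula.realize_rel.trans Iff.rfl⟩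

theorem add (i j k : α) :
    UniformlyDefinable fun _ v => (v i : ℕ) + (v j : ℕ) = (v k : ℕ) :=
  ⟨FirstOrder.Language.Relations.formula (L := arith) ArithRel.add
    ![FirstOrder.Language.Term.var i, FirstOrder.Language.Term.var j,
      FirstOrder.Language.Term.var k],
    fun _ _ => FirstOrder.Language.Formula.realize_rel.trans Iff.rfl⟩

theorem mul (i j k : α) :
    UniformlyDefinable fun _ v => (v i : ℕ) * (v j : ℕ) = (v k : ℕ) :=
  ⟨FirstOrder.Language.Relations.formula (L := arith) ArithRel.mul
    ![FirstOrder.Language.Term.var i, FirstOrder.Language.Term.var j,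
      FirstOrder.Language.Term.var k],
    fun _ _ => FirstOrder.Language.Formula.realize_rel.trans Iff.rfl⟩

theorem and (hP : UniformlyDefinable P) (hQ : UniformlyDefinable Q) :
    UniformlyDefinable fun n v => P n v ∧ Q n v := by
  obtain ⟨φ, hφ⟩ := hP
  obtain ⟨ψ, hψ⟩ := hQ
  exact ⟨φ ⊓ ψ, fun n v => by rw [FirstOrder.Language.Formula.realize_inf, hφ, hψ]⟩

theorem imp (hP : UniformlyDefinable P) (hQ : UniformlyDefinable Q) :
    UniformlyDefinable fun n v => P n v → Q n v := by
  obtain ⟨φ, hφ⟩ := hP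
  obtain ⟨ψ, hψ⟩ := hQ
  exact ⟨φ.imp ψ, fun n v => by rw [FirstOrder.Language.Formula.realize_imp, hφ, hψ]⟩

theorem comp {P : (n : ℕ) → (β → Fin n) → Prop} (hP : UniformlyDefinable P) (f : β → α) :
    UniformlyDefinable fun n (v : α → Fin n) => P n (v ∘ f) := by
  obtain ⟨φ, hφ⟩ := hP
  exact ⟨φ.relabel f, fun n v => by rw [FirstOrder.Language.Formula.realize_relabel, hφ]⟩

theorem ex [Finite β] {P : (n : ℕ) → (α ⊕ β → Fin n) → Prop} (hP : UniformlyDefinable P) :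
    UniformlyDefinable fun n (v : α → Fin n) => ∃ w : β → Fin n, P n (Sum.elim v w) := by
  obtain ⟨φ, hφ⟩ := hP
  refine ⟨φ.iExs β, fun n v => ?_⟩
  rw [FirstOrder.Language.Formula.realize_iExs]
  exact exists_congr fun w => hφ n _

theorem all [Finite β] {P : (n : ℕ) → (α ⊕ β → Fin n) → Prop} (hP : UniformlyDefinable P) :
    UniformlyDefinable fun n (v : α → Fin n) => ∀ w : β → Fin n, P n (Sum.elim v w) := by
  obtain ⟨φ, hφ⟩ := hP
  refine ⟨φ.iAlls β, fun n v => ?_⟩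
  rw [FirstOrder.Language.Formula.realize_iAlls]
  exact forall_congr' fun w => hφ n _

end UniformlyDefinable

/-! ## Roots and division by them -/

/-- The largest `a` with `a ^ (K + 1) < n`. -/
def root (K n : ℕ) : ℕ :=
  Nat.findGreatest (fun a => a ^ (K + 1) < n) n

theorem root_pow_lt (K : ℕ) {n : ℕ} (hn : 0 < n) : root K n ^ (K + 1) < n :=
  Nat.findGreatest_spec (P := fun a => a ^ (K + 1) < n) (Nat.zero_le n) (by simpa using hn)

/-- Powers are monotone. Because the inequality in `root` is strict, `a ≤ root K n` means that `a ^
(K + 1)` is still a domain element, which a formula can express. For `n = 0` no `a` qualifies, yet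
the root is 0. -/
theorem le_root_iff (K : ℕ) {n a : ℕ} (hn : 0 < n) : a ≤ root K n ↔ a ^ (K + 1) < n := by
  constructor
  · intro h
    exact (Nat.pow_le_pow_left h _).trans_lt (root_pow_lt K hn)
  · intro h
    exact Nat.le_findGreatest ((Nat.le_self_pow (Nat.succ_ne_zero K) a).trans h.le) h

theorem root_lt (K : ℕ) {n : ℕ} (hn : 0 < n) : root K n < n :=
  (Nat.le_self_pow (Nat.succ_ne_zero K) _).trans_lt (root_pow_lt K hn)

/-- Maximality of the root. This is what makes level `K + 1` consist of a single block. -/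
theorem le_root_succ_pow (K n : ℕ) : n ≤ (root K n + 1) ^ (K + 1) := by
  rcases Nat.eq_zero_or_pos n with rfl | hn
  · exact Nat.zero_le _
  · by_contra! h
    exact absurd ((le_root_iff K hn).2 h) (by omega)

theorem uniformlyDefinable_pow_eq (K : ℕ) :
    UniformlyDefinable fun _ (v : Fin 2 → Fin _) => (v 0 : ℕ) ^ (K + 1) = (v 1 : ℕ) := by
  induction K with
  | zero =>
    refine ((UniformlyDefinable.le 0 1).and (UniformlyDefinable.le 1 0)).congr fun n v => ?_
    rw [zero_add, pow_one, ← Fin.ext_iff, le_antisymm_iff]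
  | succ K ih =>
    refine ((ih.comp (α := Fin 2 ⊕ Fin 1) ![.inl 0, .inr 0]).and
      (UniformlyDefinable.mul (.inr 0) (.inl 0) (.inl 1))).ex.congr fun n v => ?_
    constructor
    · rintro ⟨w, h, h'⟩
      simp only [Function.comp_apply, Matrix.cons_val_zero, Matrix.cons_val_one, Sum.elim_inl,
        Sum.elim_inr] at h h'
      rw [pow_succ, h, h']
    · intro h
      -- The quantified lower power has to be a domain element; it is at most the next power, which
      -- is one.
      have hw : (v 0 : ℕ) ^ (K + 1) < n := by
        refine lt_of_le_of_lt ?_ (v 1).isLt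
        rw [← h]
        rcases Nat.eq_zero_or_pos (v 0 : ℕ) with h0 | h0
        · simp [h0]
        · exact Nat.pow_le_pow_right h0 (Nat.le_succ _)
      refine ⟨fun _ => ⟨_, hw⟩, ?_, ?_⟩
      · simp
      · simp only [Sum.elim_inl, Sum.elim_inr]
        rw [← h, ← pow_succ]

theorem uniformlyDefinable_le_root (K : ℕ) :
    UniformlyDefinable fun n (v : Fin 1 → Fin n) => (v 0 : ℕ) ≤ root K n := by
  refine ((uniformlyDefinable_pow_eq K).comp (α := Fin 1 ⊕ Fin 1)
    ![.inl 0, .inr 0]).ex.congr fun n v => ?_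
  rw [le_root_iff K (v 0).pos]
  constructor
  · rintro ⟨w, h⟩
    simp only [Function.comp_apply, Matrix.cons_val_zero, Matrix.cons_val_one, Sum.elim_inl,
      Sum.elim_inr] at h
    exact h ▸ (w 0).isLt
  · intro h
    exact ⟨fun _ => ⟨_, h⟩, by simp⟩

/-- The root as a bound for quantified variables. -/
def rootBound (K : ℕ) : Bound where
  toFun := root K
  definable := by
    obtain ⟨φ, hφ⟩ := uniformlyDefinable_le_root K
    exact ⟨φ, fun n a => hφ n fun _ => a⟩

theorem uniformlyDefinable_eq_root (K : ℕ) :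
    UniformlyDefinable fun n (v : Fin 1 → Fin n) => (v 0 : ℕ) = root K n := by
  refine ((uniformlyDefinable_le_root K).and
    (((uniformlyDefinable_le_root K).comp (α := Fin 1 ⊕ Fin 1) ![.inr 0]).imp
      (UniformlyDefinable.le (.inr 0) (.inl 0))).all).congr fun n v => ?_
  constructor
  · rintro ⟨h, h'⟩
    refine le_antisymm h ?_
    simpa [Fin.le_def] using h' fun _ => ⟨_, root_lt K (v 0).pos⟩
  · intro h
    refine ⟨h.le, fun w hw => ?_⟩
    simpa [Fin.le_def, h] using hw

/-- Division with remainder, with `q * (d + 1)` expanded: for `d = root K n` the divisor `d + 1` may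
equal `n` and lie outside the domain, whereas `d`, `q * d`, `q * d + q` and `r` stay inside. -/
theorem div_eq_iff_exists_add {i d q : ℕ} :
    i / (d + 1) = q ↔ ∃ r ≤ d, q * d + q + r = i := by
  have hi := Nat.div_add_mod' i (d + 1)
  constructor
  · rintro rfl
    exact ⟨i % (d + 1), Nat.le_of_lt_succ (Nat.mod_lt _ d.succ_pos), by rw [← Nat.mul_succ, hi]⟩
  · rintro ⟨r, hr, rfl⟩
    rw [← Nat.mul_succ, Nat.succ_eq_add_one, add_comm, Nat.add_mul_div_right _ _ d.succ_pos,
      Nat.div_eq_of_lt (by omega), zero_add]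

theorem uniformlyDefinable_div_root (K : ℕ) :
    UniformlyDefinable fun n (v : Fin 2 → Fin n) =>
      (v 0 : ℕ) / (root K n + 1) = (v 1 : ℕ) := by
  refine (((uniformlyDefinable_eq_root K).comp (α := Fin 2 ⊕ Fin 4) ![.inr 0]).and
    ((UniformlyDefinable.mul (.inl 1) (.inr 0) (.inr 1)).and
    ((UniformlyDefinable.add (.inr 1) (.inl 1) (.inr 2)).and
    ((UniformlyDefinable.add (.inr 2) (.inr 3) (.inl 0)).and
    (UniformlyDefinable.le (.inr 3) (.inr 0)))))).ex.congr fun n v => ?_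
  rw [div_eq_iff_exists_add]
  simp only [Function.comp_apply, Matrix.cons_val_fin_one, Sum.elim_inl, Sum.elim_inr]
  constructor
  · rintro ⟨w, h0, h1, h2, h3, h4⟩
    refine ⟨w 3, h0 ▸ h4, ?_⟩
    rw [← h3, ← h2, ← h1, h0]
  · rintro ⟨r, hr, h⟩
    -- The witnesses other than the root are partial sums or summands of `v 0`, hence domain
    -- elements.
    have hn := (v 0).isLt
    exact ⟨![⟨root K n, root_lt K (v 0).pos⟩, ⟨(v 1 : ℕ) * root K n, by omega⟩,
      ⟨(v 1 : ℕ) * root K n + (v 1 : ℕ), by omega⟩, ⟨r, by omega⟩], rfl, rfl, rfl, h, hr⟩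

theorem uniformlyDefinable_div_mul_add (K : ℕ) :
    UniformlyDefinable fun n (v : Fin 3 → Fin n) =>
      (v 0 : ℕ) / (root K n + 1) * (root K n + 1) + (v 1 : ℕ) = (v 2 : ℕ) := by
  refine (((uniformlyDefinable_eq_root K).comp (α := Fin 3 ⊕ Fin 4) ![.inr 0]).and
    (((uniformlyDefinable_div_root K).comp (α := Fin 3 ⊕ Fin 4) ![.inl 0, .inr 1]).and
    ((UniformlyDefinable.mul (.inr 1) (.inr 0) (.inr 2)).and
    ((UniformlyDefinable.add (.inr 2) (.inr 1) (.inr 3)).and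
    (UniformlyDefinable.add (.inr 3) (.inl 1) (.inl 2)))))).ex.congr fun n v => ?_
  simp only [Function.comp_apply, Matrix.cons_val_fin_one, Matrix.cons_val_zero,
    Matrix.cons_val_one, Sum.elim_inl, Sum.elim_inr]
  rw [Nat.mul_succ]
  constructor
  · rintro ⟨w, h0, h1, h2, h3, h4⟩
    rw [h1, ← h4, ← h3, ← h2, h0]
  · intro h
    have hn := (v 2).isLt
    have hq := Nat.div_le_self (v 0 : ℕ) (root K n + 1)
    have h0 := (v 0).isLt
    generalize (v 0 : ℕ) / (root K n + 1) = q at h hq ⊢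
    exact ⟨![⟨root K n, root_lt K (v 0).pos⟩, ⟨q, hq.trans_lt h0⟩,
      ⟨q * root K n, by omega⟩,
      ⟨q * root K n + q, by omega⟩],
      rfl, rfl, rfl, rfl, h⟩

/-! ## Products over sets of positions -/

section Products

variable {M : Type u} [Monoid M] {n : ℕ}

open Classical in
/-- The product, in increasing order, of the entries at the positions that satisfy `S`. -/
noncomputable def prodOn (s : Fin n → M) (S : ℕ → Prop) : M :=
  (((List.finRange n).filter fun i : Fin n => S i).map s).prod

theorem rangeProd_eq_prodOn (s : Fin n → M) (l r : Fin n) :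
    rangeProd s l r = prodOn s fun i => (l : ℕ) ≤ i ∧ i ≤ (r : ℕ) := by
  unfold rangeProd prodOn
  congr 2
  exact List.filter_congr fun i _ => by simp

theorem prodOn_congr (s : Fin n → M) {S S' : ℕ → Prop} (h : ∀ i : Fin n, S i ↔ S' i) :
    prodOn s S = prodOn s S' := by
  unfold prodOn
  congr 2
  exact List.filter_congr fun i _ => by simp [h i]

theorem prodOn_eq_one (s : Fin n → M) {S : ℕ → Prop} (h : ∀ i : Fin n, S i → s i = 1) :
    prodOn s S = 1 := by
  refine List.prod_eq_one fun x hx => ?_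
  obtain ⟨i, hi, rfl⟩ := List.mem_map.1 hx
  exact h i (by simpa using (List.mem_filter.1 hi).2)

/-- In an increasing list, the elements of `S` are those of `S₁` followed by those of `S₂`. As `M`
need not be commutative, the order hypothesis carries the claim. -/
theorem prodOn_mul (s : Fin n → M) {S S₁ S₂ : ℕ → Prop} (h : ∀ i, S i ↔ S₁ i ∨ S₂ i)
    (hlt : ∀ i k, S₁ i → S₂ k → i < k) : prodOn s S = prodOn s S₁ * prodOn s S₂ := by
  classical
  suffices H : ∀ L : List (Fin n), L.Pairwise (· < ·) →
      L.filter (fun i : Fin n => S i) = L.filter (fun i : Fin n => S₁ i) ++ L.filter (fun i : Fin n => S₂ i) by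
    unfold prodOn
    rw [H _ (List.pairwise_lt_finRange n), List.map_append, List.prod_append]
  intro L hL
  induction L with
  | nil => rfl
  | cons x L ih =>
    obtain ⟨hx, hL⟩ := List.pairwise_cons.1 hL
    by_cases h₁ : S₁ x
    · have h₂ : ¬ S₂ x := fun h₂ => lt_irrefl _ (hlt _ _ h₁ h₂)
      simpa [h, h₁, h₂] using ih hL
    · by_cases h₂ : S₂ x
      -- The head is the least element, so once it lies in `S₂` nothing after it can lie in `S₁`.
      · have : L.filter (fun i : Fin n => S₁ i) = [] := by
          simp only [List.filter_eq_nil_iff, decide_eq_true_eq]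
          exact fun y hy hS => lt_asymm (hlt _ _ hS h₂) (hx y hy)
        have ih := ih hL
        rw [this, List.nil_append] at ih
        simpa [h, h₁, h₂, this] using ih
      · simpa [h, h₁, h₂] using ih hL

theorem prodOn_mul_mul (s : Fin n → M) {S S₁ S₂ S₃ : ℕ → Prop}
    (h : ∀ i, S i ↔ S₁ i ∨ S₂ i ∨ S₃ i) (h₁₂ : ∀ i k, S₁ i → S₂ k → i < k)
    (h₁₃ : ∀ i k, S₁ i → S₃ k → i < k) (h₂₃ : ∀ i k, S₂ i → S₃ k → i < k) :
    prodOn s S = prodOn s S₁ * (prodOn s S₂ * prodOn s S₃) := by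
  rw [← prodOn_mul s (S := fun i => S₂ i ∨ S₃ i) (fun _ => Iff.rfl) h₂₃]
  exact prodOn_mul s h fun i k hi hk => hk.elim (h₁₂ i k hi) (h₁₃ i k hi)

/-- This is why old stored products remain usable after a change at a position they do not contain.
-/
theorem prodOn_update_of_not (s : Fin n → M) {S : ℕ → Prop} (p : Fin n) (m : M) (hp : ¬ S p) :
    prodOn (Function.update s p m) S = prodOn s S := by
  unfold prodOn
  congr 1
  refine List.map_congr_left fun i hi => Function.update_of_ne ?_ _ _
  rintro rfl
  exact hp (by simpa using (List.mem_filter.1 hi).2)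

theorem prodOn_eq_apply (s : Fin n → M) {S : ℕ → Prop} (p : Fin n)
    (hp : ∀ i : Fin n, S i ↔ i = p) : prodOn s S = s p := by
  classical
  have : (List.finRange n).filter (fun i : Fin n => S i) = [p] := by
    rw [List.filter_congr (q := fun i => i == p) fun i _ => by
      rw [Bool.eq_iff_iff]; simp [hp i], List.filter_beq,
      List.count_eq_one_of_mem (List.nodup_finRange n) (List.mem_finRange p)]
    rfl
  unfold prodOn
  rw [this]
  simp

/-! ## Ranges of blocks

The blocks of level `j` consist of the positions with the same quotient by `T ^ j`, which is the
index of the block. -/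

/-- A lower or upper bound: none, strict or non-strict. -/
def Bounded (o : Option Bool) (a b : ℕ) : Prop :=
  match o with
  | none => True
  | some false => a < b
  | some true => a ≤ b

/-- The positions in the same block of level `j + 1` as the `a`-th block of level `j`, whose
block of level `j` is bounded from below by `a` and from above by `b`. -/
def blockRange (T j : ℕ) (lo hi : Option Bool) (a b i : ℕ) : Prop :=
  i / T ^ j / T = a / T ∧ Bounded lo a (i / T ^ j) ∧ Bounded hi (i / T ^ j) b

theorem lt_of_div_lt {i k d : ℕ} (h : i / d < k / d) : i < k :=
  lt_of_not_ge fun hki => absurd (Nat.div_le_div_right hki) (not_le.2 h)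

theorem bounded_none (a b : ℕ) : Bounded none a b ↔ True := Iff.rfl
theorem bounded_false (a b : ℕ) : Bounded (some false) a b ↔ a < b := Iff.rfl
theorem bounded_true (a b : ℕ) : Bounded (some true) a b ↔ a ≤ b := Iff.rfl

theorem Bounded.mono_right {o : Option Bool} {a b c : ℕ} (h : Bounded o a b) (hbc : b ≤ c) :
    Bounded o a c := by
  rcases o with _ | _ | _
  · trivial
  · exact lt_of_lt_of_le h hbc
  · exact le_trans h hbc

theorem Bounded.mono_left {o : Option Bool} {a b c : ℕ} (h : Bounded o b c) (hab : a ≤ b) :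
    Bounded o a c := by
  rcases o with _ | _ | _
  · trivial
  · exact lt_of_le_of_lt hab h
  · exact le_trans hab h

/-- A range of blocks, split at one of its blocks. -/
theorem prodOn_blockRange_split (s : Fin n → M) {T j a b p : ℕ} {lo hi : Option Bool}
    (ha : a / T = p / T) (hlo : Bounded lo a p) (hhi : Bounded hi p b) :
    prodOn s (blockRange T j lo hi a b) =
      prodOn s (blockRange T j lo (some false) a p) *
        (prodOn s (fun i => i / T ^ j = p) * prodOn s (blockRange T j (some false) hi p b)) := by
  refine prodOn_mul_mul s (fun i => ?_) ?_ ?_ ?_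
  · simp only [blockRange, bounded_false]
    constructor
    · rintro ⟨h, h₁, h₂⟩
      rcases lt_trichotomy (i / T ^ j) p with h' | h' | h'
      · exact .inl ⟨h, h₁, h'⟩
      · exact .inr (.inl h')
      · exact .inr (.inr ⟨h.trans ha, h', h₂⟩)
    · rintro (⟨h, h₁, h₂⟩ | rfl | ⟨h, h₁, h₂⟩)
      · exact ⟨h, h₁, hhi.mono_left h₂.le⟩
      · exact ⟨ha.symm, hlo, hhi⟩
      · exact ⟨h.trans ha.symm, hlo.mono_right h₁.le, h₂⟩
  · rintro i k ⟨-, -, hi⟩ rfl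
    exact lt_of_div_lt hi
  · rintro i k ⟨-, -, hi⟩ ⟨-, hk, -⟩
    exact lt_of_div_lt (lt_trans hi hk)
  · rintro i k rfl ⟨-, hk, -⟩
    exact lt_of_div_lt hk

/-- A block of level `j + 1`, split at one of its blocks of level `j`. -/
theorem prodOn_block_succ (s : Fin n → M) (T j p : ℕ) :
    prodOn s (fun i => i / T ^ (j + 1) = p / T ^ (j + 1)) =
      prodOn s (blockRange T j none (some false) (p / T ^ j) (p / T ^ j)) *
        (prodOn s (fun i => i / T ^ j = p / T ^ j) *
          prodOn s (blockRange T j (some false) none (p / T ^ j) (p / T ^ j))) := by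
  -- With both bounds absent the range is the whole parent block. The upper index is then
  -- irrelevant, and no term for the first or last sibling is needed.
  rw [← prodOn_blockRange_split s (lo := none) (hi := none) (a := p / T ^ j) rfl trivial trivial]
  exact prodOn_congr s fun i => by simp [blockRange, bounded_none, pow_succ, Nat.div_div_eq_div_mul]

/-- The part of a block from a given position on. -/
theorem prodOn_suffix_succ (s : Fin n → M) (T j l : ℕ) :
    prodOn s (fun i => i / T ^ (j + 1) = l / T ^ (j + 1) ∧ l ≤ i) =
      prodOn s (fun i => i / T ^ j = l / T ^ j ∧ l ≤ i) *
        prodOn s (blockRange T j (some false) none (l / T ^ j) (l / T ^ j)) := by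
  refine prodOn_mul s (fun i => ?_) ?_
  · simp only [blockRange, bounded_false, bounded_none, pow_succ, ← Nat.div_div_eq_div_mul]
    constructor
    · rintro ⟨h, hl⟩
      rcases (Nat.div_le_div_right (c := T ^ j) hl).eq_or_lt with h' | h'
      · exact .inl ⟨h'.symm, hl⟩
      · exact .inr ⟨h, h', trivial⟩
    · rintro (⟨h, hl⟩ | ⟨h, hl, -⟩)
      · exact ⟨by rw [h], hl⟩
      · exact ⟨h, (lt_of_div_lt hl).le⟩
  · rintro i k ⟨h, -⟩ ⟨-, hk, -⟩
    exact lt_of_div_lt (h ▸ hk)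

/-- The part of a block up to a given position. -/
theorem prodOn_prefix_succ (s : Fin n → M) (T j r : ℕ) :
    prodOn s (fun i => i / T ^ (j + 1) = r / T ^ (j + 1) ∧ i ≤ r) =
      prodOn s (blockRange T j none (some false) (r / T ^ j) (r / T ^ j)) *
        prodOn s (fun i => i / T ^ j = r / T ^ j ∧ i ≤ r) := by
  refine prodOn_mul s (fun i => ?_) ?_
  · simp only [blockRange, bounded_false, bounded_none, pow_succ, ← Nat.div_div_eq_div_mul]
    constructor
    · rintro ⟨h, hl⟩
      rcases (Nat.div_le_div_right (c := T ^ j) hl).eq_or_lt with h' | h'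
      · exact .inr ⟨h', hl⟩
      · exact .inl ⟨h, trivial, h'⟩
    · rintro (⟨h, -, hl⟩ | ⟨h, hl⟩)
      · exact ⟨h, (lt_of_div_lt hl).le⟩
      · exact ⟨by rw [h], hl⟩
  · rintro i k ⟨-, -, hi⟩ ⟨h, -⟩
    exact lt_of_div_lt (h ▸ hi)

/-- A range within a block of level `j + 1` that meets several blocks of level `j`. -/
theorem prodOn_range_of_lt (s : Fin n → M) {T j l r : ℕ} (hlr : l / T ^ j < r / T ^ j)
    (h : l / T ^ j / T = r / T ^ j / T) :
    prodOn s (fun i => l ≤ i ∧ i ≤ r) =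
      prodOn s (fun i => i / T ^ j = l / T ^ j ∧ l ≤ i) *
        (prodOn s (blockRange T j (some false) (some false) (l / T ^ j) (r / T ^ j)) *
          prodOn s (fun i => i / T ^ j = r / T ^ j ∧ i ≤ r)) := by
  refine prodOn_mul_mul s (fun i => ?_) ?_ ?_ ?_
  · simp only [blockRange, bounded_false]
    constructor
    · rintro ⟨hl, hr⟩
      have hl' := Nat.div_le_div_right (c := T ^ j) hl
      have hr' := Nat.div_le_div_right (c := T ^ j) hr
      rcases hl'.eq_or_lt with h₁ | h₁
      · exact .inl ⟨h₁.symm, hl⟩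
      · rcases hr'.eq_or_lt with h₂ | h₂
        · exact .inr (.inr ⟨h₂, hr⟩)
        -- The parent of the block of `i` is squeezed between the parents for `l` and `r`, which
        -- coincide by `h`.
        · exact .inr (.inl ⟨le_antisymm (h ▸ Nat.div_le_div_right hr')
            (Nat.div_le_div_right hl'), h₁, h₂⟩)
    · rintro (⟨h₁, h₂⟩ | ⟨-, h₁, h₂⟩ | ⟨h₁, h₂⟩)
      · exact ⟨h₂, (lt_of_div_lt (h₁ ▸ hlr)).le⟩
      · exact ⟨(lt_of_div_lt h₁).le, (lt_of_div_lt h₂).le⟩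
      · exact ⟨(lt_of_div_lt (h₁ ▸ hlr)).le, h₂⟩
  · rintro i k ⟨h₁, -⟩ ⟨-, h₂, -⟩
    exact lt_of_div_lt (h₁ ▸ h₂)
  · rintro i k ⟨h₁, -⟩ ⟨h₂, -⟩
    exact lt_of_div_lt (h₁ ▸ h₂ ▸ hlr)
  · rintro i k ⟨-, -, h₁⟩ ⟨h₂, -⟩
    exact lt_of_div_lt (h₂ ▸ h₁)

/-- Blocks of level 0 are single positions, so the level-0 relations already record the sequence
itself and no separate symbol for it is needed. -/
theorem prodOn_blockRange_zero_self (s : Fin n → M) (T a : ℕ) {S : ℕ → Prop}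
    (h : ∀ i, S i ↔ i = a) : prodOn s S = prodOn s (blockRange T 0 (some true) (some true) a a) :=
  prodOn_congr s fun i => by
    rw [h, blockRange, bounded_true, bounded_true, pow_zero, Nat.div_one, ← le_antisymm_iff]
    exact ⟨fun h => ⟨by rw [h], h.symm⟩, fun h => h.2.symm⟩

end Products

/-! ## Conditions that denote elements of a monoid -/

theorem collect_eq_some_iff {m n : ℕ} {v : Fin m → Option (Fin n)} {a : Fin m → Fin n} :
    collect v = some a ↔ ∀ i, v i = some (a i) := by
  unfold collect
  constructor
  · intro h i
    split at h
    · rw [← Option.some.inj h, Option.some_get]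
    · exact absurd h (by simp)
  · intro h
    simp [h]

theorem toDomain_eq_some_iff {n a : ℕ} {b : Fin n} : toDomain n a = some b ↔ a = b := by
  unfold toDomain
  split
  · rw [Option.some_inj, Fin.ext_iff]
  · rename_i h
    simp only [reduceCtorEq, false_iff]
    rintro rfl
    exact h b.isLt

section Conditions

variable {V : Vocab.{u}} {k : ℕ}

/-- A term that can always be evaluated, with constant work. -/
structure Term.Plain (t : Term V k) : Prop where
  ok : ∀ {n : ℕ} (C : Ctx V n) (e : Fin k → Fin n), t.Ok C e
  work_le : ∀ (w : (i : V.Inst) → OpWork (V.prob i)) (n : ℕ), t.work w n ≤ 1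

/-- A condition that can always be evaluated, with constant work. -/
structure Cond.Plain (c : Cond V k) : Prop where
  ok : ∀ {n : ℕ} (C : Ctx V n) (e : Fin k → Fin n), c.Ok C e
  work_le : ∀ (w : (i : V.Inst) → OpWork (V.prob i)) (n : ℕ), c.work w n ≤ 1

theorem Term.plain_var (i : Fin k) : (Term.var i : Term V k).Plain :=
  ⟨fun _ _ => trivial, fun _ _ => le_rfl⟩

theorem Term.plain_undef : (Term.undef : Term V k).Plain :=
  ⟨fun _ _ => trivial, fun _ _ => le_rfl⟩

theorem Term.plain_fn (f : V.aux.Fun) {args : Fin (V.aux.funArity f) → Term V k}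
    (h : ∀ i, (args i).Plain) : (Term.fn f args).Plain where
  ok C e := by
    rw [Term.Ok]
    exact fun i => (h i).ok C e
  work_le w n := by
    rw [Term.work]
    exact max_le le_rfl (Finset.sup_le fun i _ => (h i).work_le w n)

namespace Cond

theorem plain_rel (R : V.aux.Rel) {args : Fin (V.aux.relArity R) → Term V k}
    (h : ∀ i, (args i).Plain) : (Cond.rel R args).Plain where
  ok C e := by
    rw [Cond.Ok]
    exact fun i => (h i).ok C e
  work_le w n := by
    rw [Cond.work]
    exact max_le le_rfl (Finset.sup_le fun i _ => (h i).work_le w n)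

theorem plain_eq {s t : Term V k} (hs : s.Plain) (ht : t.Plain) : (Cond.eq s t).Plain where
  ok C e := by rw [Cond.Ok]; exact ⟨hs.ok C e, ht.ok C e⟩
  work_le w n := by rw [Cond.work]; exact max_le (hs.work_le w n) (ht.work_le w n)

theorem plain_le {s t : Term V k} (hs : s.Plain) (ht : t.Plain) : (Cond.le s t).Plain where
  ok C e := by rw [Cond.Ok]; exact ⟨hs.ok C e, ht.ok C e⟩
  work_le w n := by rw [Cond.work]; exact max_le (hs.work_le w n) (ht.work_le w n)

theorem plain_not {c : Cond V k} (hc : c.Plain) : (Cond.not c).Plain where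
  ok C e := by rw [Cond.Ok]; exact hc.ok C e
  work_le w n := by rw [Cond.work]; exact hc.work_le w n

theorem plain_and {c d : Cond V k} (hc : c.Plain) (hd : d.Plain) : (Cond.and c d).Plain where
  ok C e := by rw [Cond.Ok]; exact ⟨hc.ok C e, hd.ok C e⟩
  work_le w n := by rw [Cond.work]; exact max_le (hc.work_le w n) (hd.work_le w n)

theorem plain_or {c d : Cond V k} (hc : c.Plain) (hd : d.Plain) : (Cond.or c d).Plain where
  ok C e := by rw [Cond.Ok]; exact ⟨hc.ok C e, hd.ok C e⟩
  work_le w n := by rw [Cond.work]; exact max_le (hc.work_le w n) (hd.work_le w n)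

/-- The condition that is always false. -/
def bot : Cond V k := .le .undef .undef

theorem plain_bot : (bot : Cond V k).Plain := plain_le Term.plain_undef Term.plain_undef

theorem eval_bot {n : ℕ} (C : Ctx V n) (e : Fin k → Fin n) : ¬ (bot : Cond V k).eval C e := by
  simp [bot, Cond.eval, Term.eval]

/-- A finite disjunction. -/
def any (L : List (Cond V k)) : Cond V k := L.foldr .or bot

/-- The work of a disjunction is the maximum over its parts, not the sum, so its length does not
matter. -/
theorem plain_any {L : List (Cond V k)} (h : ∀ c ∈ L, c.Plain) : (any L).Plain := by
  induction L with
  | nil => exact plain_bot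
  | cons c L ih =>
    exact plain_or (h c List.mem_cons_self) (ih fun d hd => h d (List.mem_cons_of_mem _ hd))

theorem eval_any {n : ℕ} (C : Ctx V n) (e : Fin k → Fin n) (L : List (Cond V k)) :
    (any L).eval C e ↔ ∃ c ∈ L, c.eval C e := by
  induction L with
  | nil => simpa [any] using eval_bot C e
  | cons c L ih =>
    rw [List.exists_mem_cons_iff, ← ih]
    simp only [any, List.foldr_cons, Cond.eval]

variable {M : Type u} {n : ℕ} {C : Ctx V n} {e : Fin k → Fin n}

/-- In a family of conditions indexed by `M`, exactly the one with index `x` is true. -/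
def Denotes (C : Ctx V n) (e : Fin k → Fin n) (c : M → Cond V k) (x : M) : Prop :=
  ∀ m, (c m).eval C e ↔ x = m

open Classical in
/-- Conditions that denote a constant. -/
noncomputable def const (x : M) (m : M) : Cond V k := if x = m then .not bot else bot

theorem plain_const (x m : M) : (const x m : Cond V k).Plain := by
  unfold const
  split
  · exact plain_not plain_bot
  · exact plain_bot

theorem denotes_const (x : M) : Denotes C e (const x) x := fun m => by
  unfold const
  split
  · rename_i h
    simpa [Cond.eval, h] using eval_bot C e
  · rename_i h
    simpa [h] using eval_bot C e

/-- Conditions that denote the value denoted by the one or the other family. -/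
def cases (b : Cond V k) (c d : M → Cond V k) (m : M) : Cond V k :=
  .or (.and b (c m)) (.and (.not b) (d m))

theorem plain_cases {b : Cond V k} {c d : M → Cond V k} (hb : b.Plain) (hc : ∀ m, (c m).Plain)
    (hd : ∀ m, (d m).Plain) (m : M) : (cases b c d m).Plain :=
  plain_or (plain_and hb (hc m)) (plain_and (plain_not hb) (hd m))

/-- Each family only has to be correct under its own guard; the uses below rely on this. -/
theorem denotes_cases {b : Cond V k} {c d : M → Cond V k} {x : M}
    (hc : b.eval C e → Denotes C e c x) (hd : ¬ b.eval C e → Denotes C e d x) :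
    Denotes C e (cases b c d) x := fun m => by
  by_cases h : b.eval C e
  · simpa [cases, Cond.eval, h] using hc h m
  · simpa [cases, Cond.eval, h] using hd h m

variable [Monoid M] [Finite M]

open Classical in
/-- Conditions that denote the product of the values denoted by two families. -/
noncomputable def prod (c d : M → Cond V k) (m : M) : Cond V k :=
  any (((Set.toFinite {x : M × M | x.1 * x.2 = m}).toFinset.toList.map fun x =>
    .and (c x.1) (d x.2)))

theorem plain_prod {c d : M → Cond V k} (hc : ∀ m, (c m).Plain) (hd : ∀ m, (d m).Plain) (m : M) :
    (prod c d m).Plain := by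
  refine plain_any fun b hb => ?_
  obtain ⟨x, -, rfl⟩ := List.mem_map.1 hb
  exact plain_and (hc _) (hd _)

/-- The product is `m` iff one of the finitely many factorizations of `m` consists of the two
denoted values. -/
theorem denotes_prod {c d : M → Cond V k} {x y : M} (hc : Denotes C e c x)
    (hd : Denotes C e d y) : Denotes C e (prod c d) (x * y) := fun m => by
  simp only [prod, eval_any, List.mem_map, Finset.mem_toList, Set.Finite.mem_toFinset,
    Set.mem_ofPred_eq]
  constructor
  · rintro ⟨_, ⟨z, hz, rfl⟩, h⟩
    rw [Cond.eval, hc, hd] at h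
    rw [← hz, h.1, h.2]
  · intro h
    refine ⟨_, ⟨(x, y), h, rfl⟩, ?_⟩
    rw [Cond.eval, hc, hd]
    exact ⟨rfl, rfl⟩

end Cond

end Conditions

/-! ## The program -/

namespace RangeEval

variable {M : Type u} [Finite M] {K n : ℕ}

/-- The auxiliary symbols: a relation for each level of blocks, each pair of kinds of bounds and
each element of the monoid, and two functions that do not change. -/
@[reducible] noncomputable def vocab (M : Type u) [Finite M] (K : ℕ) : Vocab.{u} where
  aux :=
    { Rel := ULift.{u} (Fin (K + 1) × Option Bool × Option Bool) × M
      Fun := ULift.{u} Bool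
      fintypeRel := Fintype.ofFinite _
      fintypeFun := inferInstance
      relArity := fun _ => 2
      funArity := fun _ => 2 }
  loc :=
    { Rel := PEmpty
      Fun := PEmpty
      fintypeRel := inferInstance
      fintypeFun := inferInstance
      relArity := fun _ => 0
      funArity := fun _ => 0 }
  Inst := PEmpty
  finInst := inferInstance
  prob := fun i => nomatch i

/-- The number of blocks of some level in a block of the next level. -/
def base (K n : ℕ) : ℕ := root K n + 1

/-- The intended meaning of the two functions: the index of the block of the next level, and the
index of the `x`-th block in the same block of the next level. -/
def staticValue (K n : ℕ) : Bool → ℕ → ℕ → ℕ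
  | false, i, _ => i / base K n
  | true, i, x => i / base K n * base K n + x

theorem uniformlyDefinable_staticValue (K : ℕ) (f : Bool) :
    UniformlyDefinable fun n (v : Fin 3 → Fin n) =>
      staticValue K n f (v 0) (v 1) = (v 2 : ℕ) := by
  cases f
  · exact (uniformlyDefinable_div_root K).comp ![0, 2]
  · exact uniformlyDefinable_div_mul_add K

/-- The intended meaning of the auxiliary symbols. -/
structure Invariant [Monoid M] (s : Fin n → M) (A : Str (vocab M K).aux n) : Prop where
  fn : ∀ (f : Bool) (v : Fin 2 → Fin n),
    A.fn ⟨f⟩ v = toDomain n (staticValue K n f (v 0) (v 1))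
  rel : ∀ (j : Fin (K + 1)) (lo hi : Option Bool) (m : M) (v : Fin 2 → Fin n),
    (v 0 : ℕ) / base K n = (v 1 : ℕ) / base K n →
    (A.rel (⟨(j, lo, hi)⟩, m) v ↔ prodOn s (blockRange (base K n) j lo hi (v 0) (v 1)) = m)

-- Terms and conditions that read the block structure

section Expressions

variable {k : ℕ}

/-- The index of the block of level `j`, for a position given by a term. -/
def index (t : Term (vocab M K) k) : ℕ → Term (vocab M K) k
  | 0 => t
  | j + 1 => .fn ⟨false⟩ (fun _ => index t j)

/-- The `x`-th block in the same block of the next level. -/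
def sibling (t x : Term (vocab M K) k) : Term (vocab M K) k :=
  .fn ⟨true⟩ (![t, x] : Fin 2 → Term (vocab M K) k)

/-- The product of a range of blocks as stored in the auxiliary relations. -/
def entry (j : ℕ) (lo hi : Option Bool) (s t : Term (vocab M K) k) (m : M) :
    Cond (vocab M K) k :=
  .rel (⟨(Fin.ofNat (K + 1) j, lo, hi)⟩, m) (![s, t] : Fin 2 → Term (vocab M K) k)

/-- Two terms satisfy a bound. -/
noncomputable def bounded : Option Bool → Term (vocab M K) k → Term (vocab M K) k → Cond (vocab M K) k
  | none, _, _ => .not .bot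
  | some false, s, t => .not (.le t s)
  | some true, s, t => .le s t

theorem plain_index {t : Term (vocab M K) k} (ht : t.Plain) (j : ℕ) : (index t j).Plain := by
  induction j with
  | zero => exact ht
  | succ j ih => exact Term.plain_fn _ fun _ => ih

theorem plain_sibling {t x : Term (vocab M K) k} (ht : t.Plain) (hx : x.Plain) :
    (sibling t x).Plain :=
  Term.plain_fn _ (Fin.forall_fin_two.2 ⟨ht, hx⟩)

theorem plain_entry (j : ℕ) (lo hi : Option Bool) {s t : Term (vocab M K) k} (hs : s.Plain)
    (ht : t.Plain) (m : M) : (entry j lo hi s t m).Plain :=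
  Cond.plain_rel _ (Fin.forall_fin_two.2 ⟨hs, ht⟩)

theorem plain_bounded (o : Option Bool) {s t : Term (vocab M K) k} (hs : s.Plain)
    (ht : t.Plain) : (bounded o s t).Plain := by
  rcases o with _ | _ | _
  · exact Cond.plain_not Cond.plain_bot
  · exact Cond.plain_not (Cond.plain_le ht hs)
  · exact Cond.plain_le hs ht

/-- A term has the given value. -/
def HasValue {V : Vocab.{u}} (C : Ctx V n) (e : Fin k → Fin n) (t : Term V k) (x : ℕ) : Prop :=
  ∃ a : Fin n, t.eval C e = some a ∧ (a : ℕ) = x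

theorem hasValue_var {V : Vocab.{u}} (C : Ctx V n) (e : Fin k → Fin n) (i : Fin k) :
    HasValue C e (.var i) (e i) :=
  ⟨e i, by rw [Term.eval], rfl⟩

theorem eval_bounded {C : Ctx (vocab M K) n} {e : Fin k → Fin n} (o : Option Bool)
    {t x : Term (vocab M K) k} {a b : ℕ}
    (ht : HasValue C e t a) (hx : HasValue C e x b) :
    (bounded o t x).eval C e ↔ Bounded o a b := by
  obtain ⟨a, ha, rfl⟩ := ht
  obtain ⟨b, hb, rfl⟩ := hx
  rcases o with _ | _ | _
  · simpa [bounded, bounded_none, Cond.eval] using Cond.eval_bot C e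
  · simp [bounded, bounded_false, Cond.eval, ha, hb]
  · simp [bounded, bounded_true, Cond.eval, ha, hb]

variable [Monoid M] {C : Ctx (vocab M K) n} {e : Fin k → Fin n} {s : Fin n → M}

theorem hasValue_index (hC : Invariant s C.aux) {t : Term (vocab M K) k} {x : ℕ}
    (ht : HasValue C e t x) (j : ℕ) : HasValue C e (index t j) (x / base K n ^ j) := by
  induction j with
  | zero => simpa [index] using ht
  | succ j ih =>
    obtain ⟨a, ha, hax⟩ := ih
    have hlt : (a : ℕ) / base K n < n := (Nat.div_le_self _ _).trans_lt a.isLt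
    refine ⟨⟨(a : ℕ) / base K n, hlt⟩, ?_, ?_⟩
    · have : collect (fun _ : Fin 2 => (index t j).eval C e) = some fun _ => a :=
        collect_eq_some_iff.2 fun _ => ha
      rw [index, Term.eval, this]
      exact (hC.fn false _).trans (toDomain_eq_some_iff.2 rfl)
    · simp only [hax, pow_succ, Nat.div_div_eq_div_mul]

/-- An equation of partial values: in an incomplete last parent block the sibling may lie beyond the
domain, and is then undefined. -/
theorem eval_sibling (hC : Invariant s C.aux) {t x : Term (vocab M K) k} {a b : ℕ}
    (ht : HasValue C e t a) (hx : HasValue C e x b) :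
    (sibling t x).eval C e = toDomain n (a / base K n * base K n + b) := by
  obtain ⟨a, ha, rfl⟩ := ht
  obtain ⟨b, hb, rfl⟩ := hx
  have : collect (fun i : Fin 2 => ((![t, x] : Fin 2 → Term (vocab M K) k) i).eval C e) =
      some ![a, b] := collect_eq_some_iff.2 (Fin.forall_fin_two.2 ⟨ha, hb⟩)
  rw [sibling, Term.eval, this]
  exact hC.fn true _

theorem denotes_entry (hC : Invariant s C.aux) {j : ℕ} (hj : j < K + 1) (lo hi : Option Bool)
    {t x : Term (vocab M K) k} {a b : ℕ} (ht : HasValue C e t a) (hx : HasValue C e x b)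
    (hab : a / base K n = b / base K n) :
    Cond.Denotes C e (entry j lo hi t x) (prodOn s (blockRange (base K n) j lo hi a b)) := by
  obtain ⟨a, ha, rfl⟩ := ht
  obtain ⟨b, hb, rfl⟩ := hx
  intro m
  have : collect (fun i : Fin 2 => ((![t, x] : Fin 2 → Term (vocab M K) k) i).eval C e) =
      some ![a, b] := collect_eq_some_iff.2 (Fin.forall_fin_two.2 ⟨ha, hb⟩)
  rw [entry, Cond.eval, this]
  have h := hC.rel (Fin.ofNat (K + 1) j) lo hi m ![a, b] hab
  -- `Fin.ofNat` reduces modulo `K + 1`, which is harmless for the levels in use.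
  rw [Fin.val_ofNat, Nat.mod_eq_of_lt hj] at h
  rw [← show _ ↔ prodOn s (blockRange (base K n) j lo hi a b) = m from h]
  constructor
  · rintro ⟨v, hv, h⟩
    rwa [Option.some.inj hv]
  · intro h
    exact ⟨_, rfl, h⟩

-- Products after a change

variable (M) in
/-- The product of the block of level `j` of position `p`, after position `p` was set to `x`. -/
noncomputable def newBlock (x : M) (p : Term (vocab M K) k) : ℕ → M → Cond (vocab M K) k
  | 0 => Cond.const x
  | j + 1 => Cond.prod (entry j none (some false) (index p j) (index p j))
      (Cond.prod (newBlock x p j) (entry j (some false) none (index p j) (index p j)))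

theorem plain_newBlock (x : M) {p : Term (vocab M K) k} (hp : p.Plain) (j : ℕ) :
    ∀ m, (newBlock M x p j m).Plain := by
  induction j with
  | zero => exact Cond.plain_const x
  | succ j ih =>
    have := plain_index hp j
    exact Cond.plain_prod (plain_entry _ _ _ this this)
      (Cond.plain_prod ih (plain_entry _ _ _ this this))

/-- Going up one level multiplies by the siblings strictly before and strictly after. These ranges
omit the changed position, so their old entries are still right. Since only levels below `j` are
read, `j = K + 1` is allowed. -/
theorem denotes_newBlock (hC : Invariant s C.aux) (x : M) {p : Term (vocab M K) k} {a : Fin n}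
    (hp : HasValue C e p a) {j : ℕ} (hj : j ≤ K + 1) :
    Cond.Denotes C e (newBlock M x p j) (prodOn (Function.update s a x)
      fun i => i / base K n ^ j = (a : ℕ) / base K n ^ j) := by
  induction j with
  | zero =>
    rw [prodOn_eq_apply _ a (by simp [Fin.ext_iff]), Function.update_self]
    exact Cond.denotes_const x
  | succ j ih =>
    have h := hasValue_index hC hp j
    rw [prodOn_block_succ, prodOn_update_of_not _ _ _ fun h => lt_irrefl _ h.2.2,
      prodOn_update_of_not (S := blockRange _ _ (some false) _ _ _) _ _ _
        fun h => lt_irrefl _ h.2.1]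
    exact Cond.denotes_prod (denotes_entry hC hj _ _ h h rfl)
      (Cond.denotes_prod (ih (Nat.le_of_succ_le hj)) (denotes_entry hC hj _ _ h h rfl))

variable (M) in
/-- The product of a range of blocks, after position `p` in the same block of the next level was
set to `x`. -/
noncomputable def newEntry (x : M) (j : ℕ) (lo hi : Option Bool) (p s t : Term (vocab M K) k) :
    M → Cond (vocab M K) k :=
  Cond.cases (.and (bounded lo s (index p j)) (bounded hi (index p j) t))
    (Cond.prod (entry j lo (some false) s (index p j))
      (Cond.prod (newBlock M x p j) (entry j (some false) hi (index p j) t)))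
    (entry j lo hi s t)

theorem plain_newEntry (x : M) (j : ℕ) (lo hi : Option Bool) {p s t : Term (vocab M K) k}
    (hp : p.Plain) (hs : s.Plain) (ht : t.Plain) (m : M) :
    (newEntry M x j lo hi p s t m).Plain := by
  have h := plain_index hp j
  exact Cond.plain_cases (Cond.plain_and (plain_bounded _ hs h) (plain_bounded _ h ht))
    (Cond.plain_prod (plain_entry _ _ _ hs h)
      (Cond.plain_prod (plain_newBlock x hp j) (plain_entry _ _ _ h ht)))
    (plain_entry _ _ _ hs ht) m

/-- If the block of the changed position lies within the bounds, the range is split at it and only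
the middle factor is new. Otherwise the range does not contain the position and the old entry
stands. -/
theorem denotes_newEntry (hC : Invariant s C.aux) (x : M) {j : ℕ} (hj : j < K + 1)
    (lo hi : Option Bool) {p t t' : Term (vocab M K) k} {i : Fin n} {a b : ℕ}
    (hp : HasValue C e p i) (ht : HasValue C e t a) (ht' : HasValue C e t' b)
    (ha : a / base K n = (i : ℕ) / base K n ^ j / base K n)
    (hb : b / base K n = (i : ℕ) / base K n ^ j / base K n) :
    Cond.Denotes C e (newEntry M x j lo hi p t t')
      (prodOn (Function.update s i x) (blockRange (base K n) j lo hi a b)) := by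
  have h := hasValue_index hC hp j
  have heval : (Cond.and (bounded lo t (index p j)) (bounded hi (index p j) t')).eval C e ↔
      Bounded lo a ((i : ℕ) / base K n ^ j) ∧ Bounded hi ((i : ℕ) / base K n ^ j) b := by
    rw [Cond.eval, eval_bounded lo ht h, eval_bounded hi h ht']
  refine Cond.denotes_cases (fun hc => ?_) fun hc => ?_
  · obtain ⟨hlo, hhi⟩ := heval.1 hc
    rw [prodOn_blockRange_split _ ha hlo hhi,
      prodOn_update_of_not _ _ _ fun h => lt_irrefl _ h.2.2,
      prodOn_update_of_not (S := blockRange _ _ (some false) _ _ _) _ _ _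
        fun h => lt_irrefl _ h.2.1]
    exact Cond.denotes_prod (denotes_entry hC hj _ _ ht h ha)
      (Cond.denotes_prod (denotes_newBlock hC x hp hj.le)
        (denotes_entry hC hj _ _ h ht' hb.symm))
  · rw [prodOn_update_of_not _ _ _ fun h => hc (heval.2 h.2)]
    exact denotes_entry hC hj _ _ ht ht' (ha.trans hb.symm)

-- Products for a query

variable (M) in
/-- The product of the positions from `l` on in the same block of level `j`. -/
noncomputable def suffixProd (l : Term (vocab M K) k) : ℕ → M → Cond (vocab M K) k
  | 0 => entry 0 (some true) (some true) l l
  | j + 1 => Cond.prod (suffixProd l j) (entry j (some false) none (index l j) (index l j))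

variable (M) in
/-- The product of the positions up to `r` in the same block of level `j`. -/
noncomputable def prefixProd (r : Term (vocab M K) k) : ℕ → M → Cond (vocab M K) k
  | 0 => entry 0 (some true) (some true) r r
  | j + 1 => Cond.prod (entry j none (some false) (index r j) (index r j)) (prefixProd r j)

variable (M) in
/-- The product of the positions from `l` to `r`, if these are in the same block of level `j`. -/
noncomputable def innerProd (l r : Term (vocab M K) k) : ℕ → M → Cond (vocab M K) k
  | 0 => entry 0 (some true) (some true) l l
  | j + 1 => Cond.cases (.eq (index l j) (index r j)) (innerProd l r j)
      (Cond.prod (suffixProd M l j)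
        (Cond.prod (entry j (some false) (some false) (index l j) (index r j))
          (prefixProd M r j)))

theorem plain_suffixProd {l : Term (vocab M K) k} (hl : l.Plain) (j : ℕ) :
    ∀ m, (suffixProd M l j m).Plain := by
  induction j with
  | zero => exact plain_entry _ _ _ hl hl
  | succ j ih =>
    exact Cond.plain_prod ih (plain_entry _ _ _ (plain_index hl j) (plain_index hl j))

theorem plain_prefixProd {r : Term (vocab M K) k} (hr : r.Plain) (j : ℕ) :
    ∀ m, (prefixProd M r j m).Plain := by
  induction j with
  | zero => exact plain_entry _ _ _ hr hr
  | succ j ih =>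
    exact Cond.plain_prod (plain_entry _ _ _ (plain_index hr j) (plain_index hr j)) ih

theorem plain_innerProd {l r : Term (vocab M K) k} (hl : l.Plain) (hr : r.Plain) (j : ℕ) :
    ∀ m, (innerProd M l r j m).Plain := by
  induction j with
  | zero => exact plain_entry _ _ _ hl hl
  | succ j ih =>
    have hl' := plain_index hl j
    have hr' := plain_index hr j
    exact Cond.plain_cases (Cond.plain_eq hl' hr') ih (Cond.plain_prod (plain_suffixProd hl j)
      (Cond.plain_prod (plain_entry _ _ _ hl' hr') (plain_prefixProd hr j)))

theorem denotes_suffixProd (hC : Invariant s C.aux) {l : Term (vocab M K) k} {a : ℕ}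
    (hl : HasValue C e l a) {j : ℕ} (hj : j ≤ K + 1) :
    Cond.Denotes C e (suffixProd M l j)
      (prodOn s fun i => i / base K n ^ j = a / base K n ^ j ∧ a ≤ i) := by
  induction j with
  | zero =>
    rw [prodOn_blockRange_zero_self s (base K n) a fun i => by simp +contextual]
    exact denotes_entry hC (Nat.succ_pos K) _ _ hl hl rfl
  | succ j ih =>
    rw [prodOn_suffix_succ]
    exact Cond.denotes_prod (ih (Nat.le_of_succ_le hj)) (denotes_entry hC hj _ _
      (hasValue_index hC hl j) (hasValue_index hC hl j) rfl)

theorem denotes_prefixProd (hC : Invariant s C.aux) {r : Term (vocab M K) k} {a : ℕ}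
    (hr : HasValue C e r a) {j : ℕ} (hj : j ≤ K + 1) :
    Cond.Denotes C e (prefixProd M r j)
      (prodOn s fun i => i / base K n ^ j = a / base K n ^ j ∧ i ≤ a) := by
  induction j with
  | zero =>
    rw [prodOn_blockRange_zero_self s (base K n) a fun i => by simp +contextual]
    exact denotes_entry hC (Nat.succ_pos K) _ _ hr hr rfl
  | succ j ih =>
    rw [prodOn_prefix_succ]
    exact Cond.denotes_prod (denotes_entry hC hj _ _ (hasValue_index hC hr j)
      (hasValue_index hC hr j) rfl) (ih (Nat.le_of_succ_le hj))

/-- Descend while both ends share a block. At the first level `j` where they differ, their blocks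
are still siblings, so the part strictly between them is one stored entry; if they never differ, `a
= b`. -/
theorem denotes_innerProd (hC : Invariant s C.aux) {l r : Term (vocab M K) k} {a b : ℕ}
    (hl : HasValue C e l a) (hr : HasValue C e r b) (hab : a ≤ b) {j : ℕ} (hj : j ≤ K + 1)
    (h : a / base K n ^ j = b / base K n ^ j) :
    Cond.Denotes C e (innerProd M l r j) (prodOn s fun i => a ≤ i ∧ i ≤ b) := by
  induction j with
  | zero =>
    obtain rfl : a = b := by simpa using h
    rw [prodOn_blockRange_zero_self s (base K n) a fun i => by
      rw [← le_antisymm_iff]; exact eq_comm]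
    exact denotes_entry hC (Nat.succ_pos K) _ _ hl hl rfl
  | succ j ih =>
    have hl' := hasValue_index hC hl j
    have hr' := hasValue_index hC hr j
    have heval : (Cond.eq (index l j) (index r j)).eval C e ↔
        a / base K n ^ j = b / base K n ^ j := by
      obtain ⟨a', ha, ha'⟩ := hl'
      obtain ⟨b', hb, hb'⟩ := hr'
      rw [← ha', ← hb', ← Fin.ext_iff, Cond.eval, ha, hb]
      simp [eq_comm]
    refine Cond.denotes_cases (fun hc => ih (Nat.le_of_succ_le hj) (heval.1 hc)) fun hc => ?_
    rw [pow_succ, ← Nat.div_div_eq_div_mul, ← Nat.div_div_eq_div_mul] at h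
    rw [prodOn_range_of_lt s (T := base K n) (j := j)
      (lt_of_le_of_ne (Nat.div_le_div_right hab) fun h' => hc (heval.2 h')) h]
    exact Cond.denotes_prod (denotes_suffixProd hC hl (Nat.le_of_succ_le hj))
      (Cond.denotes_prod (denotes_entry hC hj _ _ hl' hr' h)
        (denotes_prefixProd hC hr (Nat.le_of_succ_le hj)))

variable (M) in
/-- The product of the positions from `l` to `r`. -/
noncomputable def queryProd (l r : Term (vocab M K) k) : M → Cond (vocab M K) k :=
  Cond.cases (.le l r) (innerProd M l r (K + 1)) (Cond.const 1)

theorem plain_queryProd {l r : Term (vocab M K) k} (hl : l.Plain) (hr : r.Plain) (m : M) :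
    (queryProd M l r m).Plain :=
  Cond.plain_cases (Cond.plain_le hl hr) (plain_innerProd hl hr _) (Cond.plain_const 1) m

theorem denotes_queryProd (hC : Invariant s C.aux) {l r : Term (vocab M K) k} {a b : Fin n}
    (hl : HasValue C e l a) (hr : HasValue C e r b) :
    Cond.Denotes C e (queryProd M l r) (rangeProd s a b) := by
  have heval : (Cond.le l r).eval C e ↔ (a : ℕ) ≤ b := eval_bounded (some true) hl hr
  rw [rangeProd_eq_prodOn]
  refine Cond.denotes_cases (fun hc => ?_) fun hc => ?_
  -- All positions share the only block of level `K + 1`, so the descent can start there.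
  · have h0 : ∀ x : Fin n, (x : ℕ) / base K n ^ (K + 1) = 0 := fun x =>
      Nat.div_eq_of_lt (x.isLt.trans_le (le_root_succ_pow K n))
    exact denotes_innerProd hC hl hr (heval.1 hc) le_rfl ((h0 a).trans (h0 b).symm)
  · rw [prodOn_eq_one s fun i hi => absurd (heval.2 (hi.1.trans hi.2)) hc]
    exact Cond.denotes_const 1

end Expressions

end RangeEval

-- Update rules and the program

namespace RangeEval

/-- The rule for setting position `p` to `x`: a relation for level `j` is updated for all pairs of
blocks of level `j` in the same block of level `j + 1` as `p`. -/
noncomputable def relRule (M : Type u) [Finite M] [Monoid M] (K : ℕ) (x : M) (j : ℕ)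
    (lo hi : Option Bool) (m : M) : UpdateRule (vocab M K) 1 2 (Cond (vocab M K)) where
  first := .instr .skip
  numVars := 2
  -- The two variables are offsets within the parent block, each with `root K n + 1 = base K n`
  -- values.
  bound := fun _ => rootBound K
  target := fun i => sibling (index (.var (Fin.castAdd 2 0)) j) (.var (Fin.natAdd 1 i))
  main := .ret (newEntry M x j lo hi (.var (Fin.castAdd 2 0))
    (sibling (index (.var (Fin.castAdd 2 0)) j) (.var (Fin.natAdd 1 0)))
    (sibling (index (.var (Fin.castAdd 2 0)) j) (.var (Fin.natAdd 1 1))) m)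

theorem plain_target {M : Type u} [Finite M] {K : ℕ} (j : ℕ) (i : Fin 2) :
    (sibling (index (.var (Fin.castAdd 2 0)) j) (.var (Fin.natAdd 1 i)) :
      Term (vocab M K) (1 + 2)).Plain :=
  plain_sibling (plain_index (Term.plain_var _) j) (Term.plain_var _)

/-- The rule for a function that does not change. -/
noncomputable def funRule (M : Type u) [Finite M] (K : ℕ) :
    UpdateRule (vocab M K) 1 2 (Term (vocab M K)) where
  first := .instr .skip
  -- There is just the empty tuple, and its target is undefined, so nothing is updated.
  numVars := 0
  bound := fun i => i.elim0
  target := fun _ => .undef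
  main := .ret .undef

open Classical in
/-- The dynamic program for `RangeEval(M)` with blocks of `K + 1` levels. -/
noncomputable def program (M : Type u) [Monoid M] [Finite M] (K : ℕ) :
    Program (rangeEval M) where
  V := vocab M K
  -- Initially every product is neutral.
  relStart := fun R => if R.2 = 1 then ⊤ else ⊥
  funStart := fun f => (uniformlyDefinable_staticValue K f.down).choose
  relRule := fun x R => relRule M K x R.1.down.1 R.1.down.2.1 R.1.down.2.2 R.2
  funRule := fun _ _ => funRule M K
  relQuery := fun m => (.ret (queryProd M (.var 0) (.var 1) m) :
    Main (vocab M K) 2 (Cond (vocab M K) 2))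
  funQuery := fun q => nomatch q

-- Correctness: the invariant holds initially and is preserved

variable {M : Type u} [Monoid M] [Finite M] {K n : ℕ}

open Classical in
theorem invariant_start (M : Type u) [Monoid M] [Finite M] (K n : ℕ) :
    Invariant ((rangeEval M).start n) ((program M K).startAux n) where
  fn f v := by
    have hspec : ∀ b : Fin n, (uniformlyDefinable_staticValue K f).choose.Realize (push v b) ↔
        staticValue K n f (v 0) (v 1) = b := fun b =>
      (uniformlyDefinable_staticValue K f).choose_spec n (push v b)
    change (if h : ∃! b : Fin n, (uniformlyDefinable_staticValue K f).choose.Realize (push v b)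
      then some h.choose else none) = _
    split
    · rename_i h
      exact (toDomain_eq_some_iff.2 ((hspec _).1 h.choose_spec.1)).symm
    · rename_i h
      -- Without a unique solution the number lies outside the domain, and both sides are undefined.
      unfold toDomain
      split
      · rename_i hlt
        exact absurd ⟨⟨_, hlt⟩, (hspec _).2 rfl, fun b hb => Fin.ext ((hspec b).1 hb).symm⟩ h
      · rfl
  rel j lo hi m v _ := by
    have h1 : prodOn ((rangeEval M).start n) (blockRange (base K n) j lo hi (v 0) (v 1)) = 1 :=
      prodOn_eq_one _ fun _ _ => rfl
    rw [h1]
    change ((if m = 1 then ⊤ else ⊥ : arith.Formula (Fin 2))).Realize v ↔ _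
    split
    · rename_i h
      simp [h]
    · rename_i h
      simpa [FirstOrder.Language.Formula.Realize] using fun h' => h h'.symm

theorem mul_base_add_div (q : ℕ) {x : ℕ} (hx : x ≤ root K n) :
    (q * base K n + x) / base K n = q := by
  rw [add_comm, Nat.add_mul_div_right _ _ (show 0 < base K n from Nat.succ_pos _),
    Nat.div_eq_of_lt (show x < base K n from Nat.lt_succ_of_le hx), zero_add]

theorem targetAt_relRule {C : Ctx (vocab M K) n} {s : Fin n → M} (hC : Invariant s C.aux)
    (x : M) (j : ℕ) (lo hi : Option Bool) (m : M) (a : Fin 1 → Fin n) (b v : Fin 2 → Fin n) :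
    (relRule M K x j lo hi m).targetAt C a b = some v ↔
      ∀ i, (a 0 : ℕ) / base K n ^ j / base K n * base K n + (b i : ℕ) = (v i : ℕ) := by
  refine collect_eq_some_iff.trans (forall_congr' fun i => ?_)
  have hp := hasValue_index hC (hasValue_var C (Fin.append a b) (Fin.castAdd 2 0)) j
  have hx := hasValue_var C (Fin.append a b) (Fin.natAdd 1 i)
  rw [Fin.append_left] at hp
  rw [Fin.append_right] at hx
  rw [← toDomain_eq_some_iff, ← eval_sibling hC hp hx]
  rfl

/-- The answer depends on the offsets only through the target pair, so any offsets hitting `v` serve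
in `newRel`. -/
theorem returnsTrue_relRule {C : Ctx (vocab M K) n} {s : Fin n → M} (hC : Invariant s C.aux)
    (x : M) {j : ℕ} (hj : j < K + 1) (lo hi : Option Bool) (m : M) (a : Fin 1 → Fin n)
    (b v : Fin 2 → Fin n) (hb : ∀ i, (b i : ℕ) ≤ root K n)
    (hv : (relRule M K x j lo hi m).targetAt C a b = some v) :
    (relRule M K x j lo hi m).main.returnsTrue C (Fin.append a b) ↔
      prodOn (Function.update s (a 0) x) (blockRange (base K n) j lo hi (v 0) (v 1)) = m := by
  have hp := hasValue_var C (Fin.append a b) (Fin.castAdd 2 0)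
  rw [Fin.append_left] at hp
  have htv := (targetAt_relRule hC x j lo hi m a b v).1 hv
  have ht : ∀ i, HasValue C (Fin.append a b)
      (sibling (index (.var (Fin.castAdd 2 0)) j) (.var (Fin.natAdd 1 i))) (v i) := fun i =>
    ⟨v i, collect_eq_some_iff.1 hv i, rfl⟩
  have hdiv : ∀ i, (v i : ℕ) / base K n = (a 0 : ℕ) / base K n ^ j / base K n := fun i => by
    rw [← htv i, mul_base_add_div _ (hb i)]
  exact denotes_newEntry hC x hj lo hi hp (ht 0) (ht 1) (hdiv 0) (hdiv 1) m

/-- Pairs in the parent of the changed block are all rewritten with their new products. Pairs in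
another parent are not targeted, and their ranges avoid the changed position. -/
theorem invariant_step {s : Fin n → M} {A : Str (vocab M K).aux n}
    {U : (i : (vocab M K).Inst) → ((vocab M K).prob i).State n} (h : Invariant s A) (x : M)
    (a : Fin 1 → Fin n) :
    Invariant (Function.update s (a 0) x) ((program M K).nextAux A U x a) where
  fn f v := by
    rw [← h.fn f v]
    -- The target of `funRule` is undefined, so the old value is kept.
    refine dif_neg ?_
    rintro ⟨b, -, hb⟩
    have h0 : (none : Option (Fin n)) = some (v 0) := collect_eq_some_iff.1 hb (0 : Fin 2)
    exact absurd h0 (by simp)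
  rel j lo hi m v hv := by
    have hC : Invariant s ((program M K).ctx A U).aux := h
    change (relRule M K x j lo hi m).newRel ((program M K).ctx A U) a
      (A.rel (⟨(j, lo, hi)⟩, m)) v ↔ _
    by_cases hp : (v 0 : ℕ) / base K n = (a 0 : ℕ) / base K n ^ (j : ℕ) / base K n
    · have hb : ∃ b, (relRule M K x j lo hi m).Allowed b ∧
          (relRule M K x j lo hi m).targetAt ((program M K).ctx A U) a b = some v := by
        have hp' : ∀ i, (v i : ℕ) / base K n = (a 0 : ℕ) / base K n ^ (j : ℕ) / base K n :=
          Fin.forall_fin_two.2 ⟨hp, hv.symm.trans hp⟩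
        -- The offset of a block within its parent is its remainder modulo the base.
        refine ⟨fun i => ⟨(v i : ℕ) % base K n, (Nat.mod_le _ _).trans_lt (v i).isLt⟩,
          fun i => Nat.le_of_lt_succ (Nat.mod_lt _ (Nat.succ_pos _)),
          (targetAt_relRule hC x j lo hi m a _ v).2 fun i => ?_⟩
        rw [← hp' i]
        exact Nat.div_add_mod' _ _
      constructor
      · rintro (⟨b, hb, hbv, hr⟩ | ⟨-, hn⟩)
        · exact (returnsTrue_relRule hC x j.isLt lo hi m a b v hb hbv).1 hr
        · exact absurd hb hn
      · intro hm
        obtain ⟨b, hb, hbv⟩ := hb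
        exact .inl ⟨b, hb, hbv, (returnsTrue_relRule hC x j.isLt lo hi m a b v hb hbv).2 hm⟩
    · have hb : ¬ ∃ b, (relRule M K x j lo hi m).Allowed b ∧
          (relRule M K x j lo hi m).targetAt ((program M K).ctx A U) a b = some v := by
        rintro ⟨b, hb, hbv⟩
        refine hp ?_
        rw [← (targetAt_relRule hC x j lo hi m a b v).1 hbv 0]
        exact mul_base_add_div _ (hb (0 : Fin 2))
      rw [prodOn_update_of_not _ _ _ fun h => hp h.1.symm, ← h.rel j lo hi m v hv]
      constructor
      · rintro (⟨b, hb', hbv, -⟩ | ⟨ho, -⟩)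
        · exact absurd ⟨b, hb', hbv⟩ hb
        · exact ho
      · exact fun ho => .inr ⟨ho, hb⟩

theorem invariant_of_reachable {s : Fin n → M} {A : Str (vocab M K).aux n}
    {U : (i : (vocab M K).Inst) → ((vocab M K).prob i).State n}
    (h : (program M K).Reachable n s A U) : Invariant s A := by
  refine Program.Reachable.rec (motive := fun s A _ _ => Invariant s A) (invariant_start M K n)
    (fun _ x a ih => invariant_step (M := M) ih x a) h

/-- Well-definedness is plainness of the expressions: they contain no `unique`, and the program has
neither parallel branches nor supplementary instances. The answers are right by the invariant. -/
theorem correct_program (M : Type u) [Monoid M] [Finite M] (K : ℕ) :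
    (program M K).Correct where
  wellFormed :=
    { relRule := fun _ _ => ⟨trivial, trivial⟩
      funRule := fun _ _ => ⟨trivial, trivial⟩
      relQuery := fun _ => trivial
      funQuery := fun q => nomatch q
      invokes := fun _ i => nomatch i }
  relRule_ok _ _ _ _ _ _ _ _ :=
    ⟨trivial, fun _ _ => ⟨fun i => (plain_target _ i).ok _ _,
      (plain_newEntry (M := M) _ _ _ _ (Term.plain_var _) (plain_target _ 0)
        (plain_target _ 1) _).ok _ _⟩⟩
  funRule_ok _ _ _ _ _ _ _ _ :=
    ⟨⟨trivial, fun _ _ => ⟨fun _ => Term.plain_undef.ok _ _, Term.plain_undef.ok _ _⟩⟩,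
      fun _ _ _ _ _ _ _ => rfl⟩
  relQuery_ok _ _ _ _ h m a :=
    ⟨(plain_queryProd (Term.plain_var _) (Term.plain_var _) _).ok _ _,
      denotes_queryProd (C := (program M K).ctx _ _) (invariant_of_reachable h)
        (hasValue_var _ a (0 : Fin 2)) (hasValue_var _ a (1 : Fin 2)) m⟩
  funQuery_ok _ _ _ _ _ q := nomatch q

-- Work bounds

/-- Two offset variables contribute a factor `root K n + 1` each; everything inside the rule is
plain and costs 1. -/
theorem work_change_le (w : (i : (vocab M K).Inst) → OpWork ((vocab M K).prob i)) (x : M) :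
    ((program M K).opWork w).change x n ≤ (root K n + 1) ^ 2 := by
  have h1 : 1 ≤ (root K n + 1) ^ 2 := Nat.one_le_pow _ _ (Nat.succ_pos _)
  refine max_le (Finset.sup_le fun R _ => max_le h1 ?_) (Finset.sup_le fun f _ => max_le h1 ?_)
  · change (∏ _ : Fin 2, (root K n + 1)) * max (max 1 _) _ ≤ _
    rw [Finset.prod_const, Finset.card_univ, Fintype.card_fin]
    refine (Nat.mul_le_mul_left _ ?_).trans (Nat.mul_one _).le
    exact max_le (max_le le_rfl ((plain_newEntry _ _ _ _ (Term.plain_var _) (plain_target _ 0)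
      (plain_target _ 1) _).work_le w n)) (Finset.sup_le fun i _ => (plain_target _ i).work_le w n)
  · change (∏ i : Fin 0, _) * max (max 1 _) _ ≤ _
    rw [Finset.univ_eq_empty, Finset.prod_empty, one_mul]
    exact (max_le (max_le le_rfl (Term.plain_undef.work_le w n))
      (Finset.sup_le fun i _ => Term.plain_undef.work_le w n)).trans h1

theorem work_relQuery_le (w : (i : (vocab M K).Inst) → OpWork ((vocab M K).prob i)) (m : M) :
    ((program M K).opWork w).relQuery m n ≤ 1 :=
  max_le le_rfl ((plain_queryProd (Term.plain_var _) (Term.plain_var _) m).work_le w n)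

theorem root_le_rpow (K : ℕ) (hn : 0 < n) : (root K n : ℝ) ≤ (n : ℝ) ^ ((K + 1 : ℝ)⁻¹) := by
  have h : ((root K n : ℝ)) ^ (K + 1) ≤ n := by exact_mod_cast (root_pow_lt K hn).le
  calc (root K n : ℝ) = ((root K n : ℝ) ^ (K + 1)) ^ ((K + 1 : ℕ) : ℝ)⁻¹ :=
        (Real.pow_rpow_inv_natCast (Nat.cast_nonneg _) (Nat.succ_ne_zero K)).symm
    _ ≤ (n : ℝ) ^ ((K + 1 : ℕ) : ℝ)⁻¹ := Real.rpow_le_rpow (by positivity) h (by positivity)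
    _ = _ := by push_cast; rfl

theorem isBigO_rpow_of_le_root {ε : ℝ} (hK : 2 ≤ ε * (K + 1)) {f : ℕ → ℕ}
    (hf : ∀ n, f n ≤ (root K n + 1) ^ 2) :
    (fun n => (f n : ℝ)) =O[atTop] fun n : ℕ => (n : ℝ) ^ ε := by
  -- For `n ≥ 1`, `root K n + 1` is at most twice `n ^ (1 / (K + 1))`; squaring gives the constant 4
  -- and the exponent `2 / (K + 1) ≤ ε`.
  refine IsBigO.of_bound 4 ?_
  filter_upwards [eventually_ge_atTop 1] with n hn
  have hn' : (1 : ℝ) ≤ n := by exact_mod_cast hn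
  have hK0 : (0 : ℝ) < K + 1 := by positivity
  have h1 : (1 : ℝ) ≤ (n : ℝ) ^ ((K + 1 : ℝ)⁻¹) := Real.one_le_rpow hn' (by positivity)
  have h2 : (f n : ℝ) ≤ ((root K n : ℝ) + 1) ^ 2 := by exact_mod_cast hf n
  rw [Real.norm_of_nonneg (Nat.cast_nonneg _), Real.norm_of_nonneg (by positivity)]
  calc (f n : ℝ) ≤ ((root K n : ℝ) + 1) ^ 2 := h2
    _ ≤ (2 * (n : ℝ) ^ ((K + 1 : ℝ)⁻¹)) ^ 2 := by
        refine pow_le_pow_left₀ (by positivity) ?_ 2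
        linarith [root_le_rpow K hn]
    _ = 4 * (n : ℝ) ^ ((K + 1 : ℝ)⁻¹ * 2) := by
        rw [mul_pow, Real.rpow_mul (Nat.cast_nonneg n), Real.rpow_two]
        norm_num
    _ ≤ 4 * (n : ℝ) ^ ε := by
        refine mul_le_mul_of_nonneg_left (Real.rpow_le_rpow_of_exponent_le hn' ?_) (by norm_num)
        rwa [inv_mul_le_iff₀ hK0, mul_comm]

end RangeEval

end DynFO

theorem mainTheorem4 (M : Type*) [Monoid M] [Finite M] (ε : ℝ) (hε : 0 < ε) :
    DynFO.MaintainableWithWork (DynFO.rangeEval M) (fun n : ℕ => (n : ℝ) ^ ε) := by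
  -- The exponent of the work is `2 / (K + 1)`, so this many levels bring it down to `ε`.
  obtain ⟨K, hK⟩ := exists_nat_ge (2 / ε)
  have hK' : 2 ≤ ε * (K + 1) := by
    rw [div_le_iff₀' hε] at hK
    linarith
  refine ⟨(DynFO.RangeEval.program M K).opWork (fun i => nomatch i),
    .intro _ _ (fun i => nomatch i) (DynFO.RangeEval.correct_program M K), fun x => ?_,
    fun m => ?_, fun q => nomatch q⟩
  · exact DynFO.RangeEval.isBigO_rpow_of_le_root hK' fun n =>
      DynFO.RangeEval.work_change_le (M := M) _ x
  · exact DynFO.RangeEval.isBigO_rpow_of_le_root hK' fun n =>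
      (DynFO.RangeEval.work_relQuery_le (M := M) _ m).trans (Nat.one_le_pow _ _ (Nat.succ_pos _))
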